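/- Rings are associative and need not have an identity. A ring $R$ has local units if every finite subset of $R$ is contained in $eRe$ for some idempotent $e\in R$. A left $R$-module $M$ is unitary if $RM=M$, where $RM$ is the set of finite sums of elements $rm$; similarly for right modules. Write $R\mathrm{Mod}$ (resp. $\mathrm{Mod}S$) for the category of unitary left $R$-modules (resp. unitary right $S$-modules). Two rings $R$ and $S$ with local units are Morita equivalent if there is a (covariant) equivalence of categories between $R\mathrm{Mod}$ and $S\mathrm{Mod}$. A direct system $(X_i,\varphi_{ij})$ of unitary modules over a quasi-ordered directed set is split if for all $i\le j$ there is a homomorphism $\psi_{ji}\colon X_j\to X_i$ such that $\varphi_{ij}$ followed by $\psi_{ji}$ is $\mathrm{id}_{X_i}$, and, for $i\le j\le k$, $\psi_{kj}$ followed by $\psi_{ji}$ is $\psi_{ki}$. A unitary module is locally projective if it is a direct limit of a split direct system of finitely generated unitary modules that are projective in the category of unitary modules. A unitary module $P$ is a generator if for any two distinct homomorphisms $f,g\colon M\to B$ of unitary modules there is a homomorphism $h\colon P\to M$ such that $h$ followed by $f$ differs from $h$ followed by $g$. A unitary $R$-$S$-bimodule $P$ is an $R$-$S$-bimodule that is unitary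 as a left $R$-module and as a right $S$-module. Write endomorphisms of ${}_RP$ on the right (so $fg$ means first $f$, then $g$) and endomorphisms of $P_S$ on the left, and let $\mu\colon S\to\mathrm{End}_R(P)$, $\mu_s\colon x\mapsto xs$, and $\lambda\colon R\to\mathrm{End}_S(P)$, $\lambda_r\colon x\mapsto rx$, be the canonical ring homomorphisms. Let $(\mathrm{Im}\,\mu)\mathrm{End}_R(P)$ be the set of finite sums of products $\mu_s f$ with $s\in S$, $f\in\mathrm{End}_R(P)$, and let $\mathrm{End}_S(P)(\mathrm{Im}\,\lambda)$ be the set of finite sums of products $g\circ\lambda_r$ with $g\in\mathrm{End}_S(P)$, $r\in R$. The bimodule $P$ is balanced if $\lambda$ and $\mu$ are injective, $(\mathrm{Im}\,\mu)\mathrm{End}_R(P)=\mathrm{Im}\,\mu$ and $\mathrm{End}_S(P)(\mathrm{Im}\,\lambda)=\mathrm{Im}\,\lambda$. **Corollary.** Let $R$ and $S$ be rings with local units. The following conditions are equivalent. (a) $R$ and $S$ are Morita equivalent. (b) There exists a balanced unitary $R$-$S$-bimodule $P$ such that ${}_RP$ and $P_S$ are locally projective generators in $R\mathrm{Mod}$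 and $\mathrm{Mod}S$, respectively. (c) There exists a unitary $R$-$S$-bimodule $P$ such that (i) ${}_RP$ is a locally projective generator in $R\mathrm{Mod}$; (ii) the map $\mu\colon S\to\mathrm{End}_R(P)$ is injective and $(\mathrm{Im}\,\mu)\mathrm{End}_R(P)=\mathrm{Im}\,\mu$; (iii) $Pf$ is a finitely generated left $R$-module for each idempotent $f\in S$. -/

import Mathlib

open CategoryTheory CategoryTheory.Limits

universe u

/-- A ring with local units: every finite subset of `R` is contained in a subring of the form
`eRe` with `e` idempotent. Rings are associative and need not have an identity. -/
def HasLocalUnits (R : Type u) [NonUnitalRing R] : Prop :=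
  ∀ X : Finset R, ∃ e : R, e * e = e ∧ (X : Set R) ⊆ {x | ∃ r : R, x = e * r * e}

/-- A left module over a ring `R` which need not have an identity. A right `S`-module is
a left module over the opposite ring `Sᵐᵒᵖ`, where `x s` is `MulOpposite.op s • x`. -/
class NonUnitalModule (R : Type u) (M : Type u) [NonUnitalRing R] [AddCommGroup M] extends
    DistribSMul R M, SemigroupAction R M where
  add_smul : ∀ (r s : R) (x : M), (r + s) • x = r • x + s • x

/-- A module `M` is unitary if `RM = M`, where `RM` is the set of finite sums of elements `r • m`. -/
def IsUnitaryModule (R M : Type u) [NonUnitalRing R] [AddCommGroup M] [NonUnitalModule R M] :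
    Prop :=
  AddSubgroup.closure {x : M | ∃ (r : R) (m : M), x = r • m} = ⊤

/-- An additive subgroup of a module is an `R`-submodule. -/
def IsRSubmodule (R : Type u) {M : Type u} [NonUnitalRing R] [AddCommGroup M]
    [NonUnitalModule R M] (N : AddSubgroup M) : Prop :=
  ∀ (r : R), ∀ x ∈ N, r • x ∈ N

/-- `N` is a finitely generated `R`-submodule of `M`: it is a submodule, and it is the smallest
submodule containing some finite set. -/
def IsFGSubmodule (R : Type u) {M : Type u} [NonUnitalRing R] [AddCommGroup M]
    [NonUnitalModule R M] (N : AddSubgroup M) : Prop :=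
  IsRSubmodule R N ∧ ∃ X : Finset M, (X : Set M) ⊆ N ∧
    ∀ K : AddSubgroup M, IsRSubmodule R K → (X : Set M) ⊆ K → N ≤ K

/-- Homomorphisms of modules over a ring without identity. -/
@[ext]
structure ModHom (R M N : Type u) [NonUnitalRing R] [AddCommGroup M] [AddCommGroup N]
    [NonUnitalModule R M] [NonUnitalModule R N] extends M →+ N where
  map_smul' : ∀ (r : R) (x : M), toFun (r • x) = r • toFun x

/-- The category `RMod` of unitary left `R`-modules: objects. The category `ModS` of unitary right
`S`-modules is `UMod Sᵐᵒᵖ`. -/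
structure UMod (R : Type u) [NonUnitalRing R] where
  carrier : Type u
  [addCommGroup : AddCommGroup carrier]
  [module : NonUnitalModule R carrier]
  unitary : IsUnitaryModule R carrier

attribute [instance] UMod.addCommGroup UMod.module

/-- The category `RMod` of unitary left `R`-modules and all `R`-module homomorphisms. -/
instance UMod.category (R : Type u) [NonUnitalRing R] : Category.{u, u + 1} (UMod R) where
  Hom M N := ModHom R M.carrier N.carrier
  id M := { AddMonoidHom.id M.carrier with map_smul' := fun _ _ => rfl }
  comp f g :=
    { g.toAddMonoidHom.comp f.toAddMonoidHom with
      map_smul' := fun r x => by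
        change g.toFun (f.toFun (r • x)) = r • g.toFun (f.toFun x)
        rw [f.map_smul', g.map_smul'] }

/-- Morita equivalence: the categories of unitary left modules are equivalent. -/
def AreMoritaEquivalent (R S : Type u) [NonUnitalRing R] [NonUnitalRing S] : Prop :=
  Nonempty (UMod R ≌ UMod S)

/-- A unitary module is finitely generated. -/
def UMod.IsFG {R : Type u} [NonUnitalRing R] (M : UMod R) : Prop :=
  IsFGSubmodule R (⊤ : AddSubgroup M.carrier)

/-- A direct system `F` of unitary modules over a quasi-ordered directed set is split if its
transition maps `φ_{ij} : F i ⟶ F j` (for `i ≤ j`) have retractions `ψ_{ji} : F j ⟶ F i` such that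
`ψ_{kj}` followed by `ψ_{ji}` is `ψ_{ki}` for `i ≤ j ≤ k`. -/
def IsSplitSystem {R : Type u} [NonUnitalRing R] {I : Type u} [Preorder I] (F : I ⥤ UMod R) :
    Prop :=
  ∃ ψ : ∀ i j : I, i ≤ j → (F.obj j ⟶ F.obj i),
    (∀ (i j : I) (h : i ≤ j), F.map (homOfLE h) ≫ ψ i j h = 𝟙 (F.obj i)) ∧
    ∀ (i j k : I) (h : i ≤ j) (h' : j ≤ k), ψ j k h' ≫ ψ i j h = ψ i k (h.trans h')

/-- A unitary module is locally projective if it is a direct limit of a split direct system of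
finitely generated modules that are projective objects of the category of unitary modules. -/
def UMod.IsLocallyProjective {R : Type u} [NonUnitalRing R] (P : UMod R) : Prop :=
  ∃ (I : Type u) (_ : Preorder I) (_ : IsDirectedOrder I) (_ : Nonempty I) (F : I ⥤ UMod R),
    IsSplitSystem F ∧ (∀ i, (F.obj i).IsFG ∧ Projective (F.obj i)) ∧
    ∃ c : Cocone F, Nonempty (IsColimit c) ∧ Nonempty (c.pt ≅ P)

/-- A locally projective generator. That `P` is a generator means that for any distinct
`f, g : M ⟶ B` of unitary modules there is `h : P ⟶ M` with `h ≫ f ≠ h ≫ g`;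
this is Mathlib's `IsSeparator`. -/
def UMod.IsLocallyProjectiveGenerator {R : Type u} [NonUnitalRing R] (P : UMod R) : Prop :=
  P.IsLocallyProjective ∧ IsSeparator P

/-- Unitary `R`-`S`-bimodules: unitary left `R`-modules that are also unitary right `S`-modules and
satisfy `(r x) s = r (x s)`. -/
structure UnitaryBimodule (R S : Type u) [NonUnitalRing R] [NonUnitalRing S] where
  carrier : Type u
  [addCommGroup : AddCommGroup carrier]
  [leftModule : NonUnitalModule R carrier]
  [rightModule : NonUnitalModule Sᵐᵒᵖ carrier]
  [smulComm : SMulCommClass R Sᵐᵒᵖ carrier]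
  left_unitary : IsUnitaryModule R carrier
  right_unitary : IsUnitaryModule Sᵐᵒᵖ carrier

attribute [instance] UnitaryBimodule.addCommGroup UnitaryBimodule.leftModule
  UnitaryBimodule.rightModule UnitaryBimodule.smulComm

/-- The ring of endomorphisms of a module, with product `f * g = f ∘ g`. -/
def endSubring (R M : Type u) [NonUnitalRing R] [AddCommGroup M] [NonUnitalModule R M] :
    Subring (AddMonoid.End M) where
  carrier := {f | ∀ (r : R) (x : M), f (r • x) = r • f x}
  mul_mem' {f g} hf hg r x := by
    change f (g (r • x)) = r • f (g x)
    rw [hg, hf]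
  one_mem' _ _ := rfl
  add_mem' {f g} hf hg r x := by
    change f (r • x) + g (r • x) = r • (f x + g x)
    rw [hf, hg, smul_add]
  zero_mem' r _ := (smul_zero r).symm
  neg_mem' {f} hf r x := by
    change -f (r • x) = r • -f x
    rw [hf, eq_comm, eq_neg_iff_add_eq_zero, ← smul_add, neg_add_cancel, smul_zero]

namespace UnitaryBimodule

variable {R S : Type u} [NonUnitalRing R] [NonUnitalRing S] (P : UnitaryBimodule R S)

/-- The unitary left module `_R P`. -/
def left : UMod R := ⟨P.carrier, P.left_unitary⟩

/-- The unitary right module `P_S`. -/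
def right : UMod Sᵐᵒᵖ := ⟨P.carrier, P.right_unitary⟩

/-- The ring `End_R(P)`; maps are written on the right, so that `f * g` is "first `f`, then `g`". -/
abbrev LeftEnd : Type u := (endSubring R P.carrier)ᵐᵒᵖ

/-- The ring `End_S(P)`; maps are written on the left, so that `f * g` is `f ∘ g`. -/
abbrev RightEnd : Type u := endSubring Sᵐᵒᵖ P.carrier

/-- The ring homomorphism `μ : S → End_R(P)`, `μ_s : x ↦ x s`. -/
def mu : S →ₙ+* P.LeftEnd where
  toFun s := MulOpposite.op
    ⟨DistribSMul.toAddMonoidHom P.carrier (MulOpposite.op s),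
      fun r x => (smul_comm r (MulOpposite.op s) x).symm⟩
  map_mul' s t := MulOpposite.unop_injective <| Subtype.ext <| AddMonoidHom.ext fun x =>
    SemigroupAction.mul_smul (MulOpposite.op t) (MulOpposite.op s) x
  map_add' s t := MulOpposite.unop_injective <| Subtype.ext <| AddMonoidHom.ext fun x =>
    NonUnitalModule.add_smul (MulOpposite.op s) (MulOpposite.op t) x
  map_zero' := MulOpposite.unop_injective <| Subtype.ext <| AddMonoidHom.ext fun x => by
    have h := NonUnitalModule.add_smul (MulOpposite.op (0 : S)) (MulOpposite.op (0 : S)) x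
    rw [← MulOpposite.op_add, add_zero] at h
    exact left_eq_add.mp h

/-- The ring homomorphism `λ : R → End_S(P)`, `λ_r : x ↦ r x`. -/
def lam : R →ₙ+* P.RightEnd where
  toFun r := ⟨DistribSMul.toAddMonoidHom P.carrier r, fun s x => smul_comm r s x⟩
  map_mul' r t := Subtype.ext <| AddMonoidHom.ext fun x => SemigroupAction.mul_smul r t x
  map_add' r t := Subtype.ext <| AddMonoidHom.ext fun x => NonUnitalModule.add_smul r t x
  map_zero' := Subtype.ext <| AddMonoidHom.ext fun x => by
    have h := NonUnitalModule.add_smul (0 : R) (0 : R) x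
    rw [add_zero] at h
    exact left_eq_add.mp h

/-- `(Im μ) End_R(P) = Im μ`, where the left side is the set of finite sums of products
`μ_s g` with `g ∈ End_R(P)`. -/
def MuIdeal : Prop :=
  (AddSubgroup.closure {h : P.LeftEnd | ∃ (s : S) (g : P.LeftEnd), h = P.mu s * g} :
    Set P.LeftEnd) = Set.range P.mu

/-- `End_S(P) (Im λ) = Im λ`, where the left side is the set of finite sums of products
`g λ_r` with `g ∈ End_S(P)`. -/
def LamIdeal : Prop :=
  (AddSubgroup.closure {h : P.RightEnd | ∃ (g : P.RightEnd) (r : R), h = g * P.lam r} :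
    Set P.RightEnd) = Set.range P.lam

/-- A balanced bimodule. -/
def IsBalanced : Prop :=
  Function.Injective P.lam ∧ Function.Injective P.mu ∧ P.MuIdeal ∧ P.LamIdeal

/-- The subgroup `Pf = {x f | x ∈ P}` of `P`, for `f ∈ S`. -/
def mulRight (f : S) : AddSubgroup P.carrier :=
  (DistribSMul.toAddMonoidHom P.carrier (MulOpposite.op f)).range

end UnitaryBimodule

/-! Everything passes through a Morita context: bimodules `P` and `Q` with pairings (p, q) ∈ R and
[q, p] ∈ S that are associative and onto, in the sense of finite sums.

Given (c), let Q be the set of R-linear q : P → R with q(xs) = q(x) for some s ∈ S, and let (p, q) =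
q(p). This pairing is onto because a generator has full trace ideal. The endomorphism x ↦ q(x)p is
unchanged by first applying μ_s, so by (ii) it is μ_t for a unique t, and [q, p] = t. For onto-ness,
an idempotent f ∈ S has Pf finitely generated, and local projectivity gives a dual basis (a_j, p_j)
valid on Pf. Then xf = ∑ a_j(xf)p_j writes f, and every s = fs, as a sum of pairings
(`nonempty_surjectiveMoritaContext`).

From the context, m ↦ (q ↦ (x ↦ (x, q)m)) is an isomorphism onto the iterated unitary Hom
(`unitHom_bijective`). This and its mirror image give (a). Writing elements of R and S as sums of
pairings also gives the missing half of (b), for the same P.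

For (a) ⇒ (c), P is the image of the regular module S under the equivalence, with S acting through
right multiplications. Finite generation is expressed by jointly epimorphic families, so that it is
transported (`isFG_iff_isFinGenObject`).

For (b) ⇒ (c), write f = ∑ b_j(p_j) with functionals b_j of P_S. The endomorphisms x ↦ y b_j(x) act
on the p_j as elements of R, so the p_j f generate Pf. -/

section Modules

variable {R M N : Type u} [NonUnitalRing R] [AddCommGroup M] [AddCommGroup N]
  [NonUnitalModule R M] [NonUnitalModule R N]

/-! ### Modules over rings with local units -/

namespace NonUnitalModule

/-- For fixed `x`, the additive map `r ↦ r • x`. -/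
def smulHom (R : Type u) {M : Type u} [NonUnitalRing R] [AddCommGroup M] [NonUnitalModule R M]
    (x : M) : R →+ M :=
  AddMonoidHom.mk' (fun r => r • x) fun r s => add_smul r s x

theorem zero_smul' (x : M) : (0 : R) • x = 0 := (smulHom R x).map_zero

theorem smul_neg' (r : R) (x : M) : r • (-x) = -(r • x) :=
  (DistribSMul.toAddMonoidHom M r).map_neg x

theorem smul_sum' {ι : Type*} (s : Finset ι) (r : R) (x : ι → M) :
    r • ∑ i ∈ s, x i = ∑ i ∈ s, r • x i :=
  map_sum (DistribSMul.toAddMonoidHom M r) x s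

theorem sum_smul' {ι : Type*} (s : Finset ι) (r : ι → R) (x : M) :
    (∑ i ∈ s, r i) • x = ∑ i ∈ s, r i • x :=
  map_sum (smulHom R x) r s

end NonUnitalModule

open NonUnitalModule

/-- A ring as a left module over itself. -/
instance regularModule (R : Type u) [NonUnitalRing R] : NonUnitalModule R R :=
  { (inferInstance : DistribSMul R R) with
    mul_smul := mul_assoc
    add_smul := add_mul }

theorem regular_smul_def (r x : R) : r • x = r * x := rfl

/-- Finite (or infinite) products of copies of a module. -/
instance piModule (R M ι : Type u) [NonUnitalRing R] [AddCommGroup M] [NonUnitalModule R M] :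
    NonUnitalModule R (ι → M) where
  smul r x i := r • x i
  smul_zero r := funext fun _ => smul_zero r
  smul_add r x y := funext fun i => smul_add r (x i) (y i)
  mul_smul r s x := funext fun i => SemigroupAction.mul_smul r s (x i)
  add_smul r s x := funext fun i => NonUnitalModule.add_smul r s (x i)

/-- The product of two modules. -/
instance prodModule : NonUnitalModule R (M × N) where
  smul r x := (r • x.1, r • x.2)
  smul_zero r := Prod.ext (smul_zero r) (smul_zero r)
  smul_add r x y := Prod.ext (smul_add r x.1 y.1) (smul_add r x.2 y.2)
  mul_smul r s x := Prod.ext (SemigroupAction.mul_smul r s x.1) (SemigroupAction.mul_smul r s x.2)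
  add_smul r s x := Prod.ext (NonUnitalModule.add_smul r s x.1) (NonUnitalModule.add_smul r s x.2)

theorem HasLocalUnits.exists_mul (hR : HasLocalUnits R) (X : Finset R) :
    ∃ e : R, e * e = e ∧ ∀ x ∈ X, e * x = x ∧ x * e = x := by
  obtain ⟨e, he, h⟩ := hR X
  refine ⟨e, he, fun x hx => ?_⟩
  obtain ⟨r, rfl⟩ := h hx
  exact ⟨by rw [← mul_assoc, ← mul_assoc, he], by rw [mul_assoc, he]⟩

theorem HasLocalUnits.op (hR : HasLocalUnits R) : HasLocalUnits Rᵐᵒᵖ := by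
  classical
  intro X
  obtain ⟨e, he, h⟩ := hR (X.image MulOpposite.unop)
  refine ⟨MulOpposite.op e, by rw [← MulOpposite.op_mul, he], fun x hx => ?_⟩
  obtain ⟨r, hr⟩ := h (Finset.mem_coe.2 (Finset.mem_image_of_mem _ hx))
  exact ⟨MulOpposite.op r, MulOpposite.unop_injective (by simp [hr, mul_assoc])⟩

theorem isUnitaryModule_of_forall (h : ∀ x : M, ∃ r : R, r • x = x) : IsUnitaryModule R M := by
  refine eq_top_iff.2 fun x _ => ?_
  obtain ⟨r, hr⟩ := h x
  exact AddSubgroup.subset_closure ⟨r, x, hr.symm⟩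

theorem IsUnitaryModule.exists_smul_eq (hM : IsUnitaryModule R M) (hR : HasLocalUnits R) (x : M) :
    ∃ r : R, r • x = x := by
  classical
  have hx : x ∈ AddSubgroup.closure {x : M | ∃ (r : R) (m : M), x = r • m} := hM ▸ trivial
  induction hx using AddSubgroup.closure_induction with
  | mem x hx =>
    obtain ⟨r, m, rfl⟩ := hx
    obtain ⟨e, -, he⟩ := hR.exists_mul {r}
    exact ⟨e, by rw [← SemigroupAction.mul_smul, (he r (by simp)).1]⟩
  | zero => exact ⟨0, smul_zero _⟩
  | neg x _ ih =>
    obtain ⟨r, hr⟩ := ih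
    exact ⟨r, by rw [smul_neg', hr]⟩
  | add x y _ _ ihx ihy =>
    obtain ⟨r, hr⟩ := ihx
    obtain ⟨s, hs⟩ := ihy
    obtain ⟨e, -, he⟩ := hR.exists_mul {r, s}
    refine ⟨e, ?_⟩
    rw [smul_add]
    nth_rw 1 [← hr]
    nth_rw 1 [← hs]
    rw [← SemigroupAction.mul_smul, ← SemigroupAction.mul_smul, (he r (by simp)).1,
      (he s (by simp)).1, hr, hs]

theorem IsUnitaryModule.exists_idempotent (hM : IsUnitaryModule R M) (hR : HasLocalUnits R)
    (X : Finset M) : ∃ e : R, e * e = e ∧ ∀ x ∈ X, e • x = x := by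
  classical
  choose r hr using hM.exists_smul_eq hR
  obtain ⟨e, hee, he⟩ := hR.exists_mul (X.image r)
  refine ⟨e, hee, fun x hx => ?_⟩
  rw [← hr x, ← SemigroupAction.mul_smul, (he _ (Finset.mem_image_of_mem r hx)).1]

theorem HasLocalUnits.isUnitaryModule (hR : HasLocalUnits R) : IsUnitaryModule R R :=
  isUnitaryModule_of_forall fun x => by
    obtain ⟨e, -, he⟩ := hR.exists_mul {x}
    exact ⟨e, (he x (by simp)).1⟩

theorem IsUnitaryModule.of_surjective (hM : IsUnitaryModule R M) (f : M →+ N)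
    (hf : ∀ (r : R) x, f (r • x) = r • f x) (hs : Function.Surjective f) :
    IsUnitaryModule R N := by
  refine eq_top_iff.2 fun y hy => ?_
  obtain ⟨x, rfl⟩ := hs y
  clear hy
  have hx : x ∈ AddSubgroup.closure {x : M | ∃ (r : R) (m : M), x = r • m} := hM ▸ trivial
  induction hx using AddSubgroup.closure_induction with
  | mem x hx =>
    obtain ⟨r, m, rfl⟩ := hx
    exact AddSubgroup.subset_closure ⟨r, f m, hf r m⟩
  | zero => rw [map_zero]; exact zero_mem _
  | neg x _ ih => rw [map_neg]; exact neg_mem ih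
  | add x y _ _ ihx ihy => rw [map_add]; exact add_mem ihx ihy

/-- The quotient of a module by a submodule. -/
abbrev quotientModule (L : AddSubgroup M) (hL : IsRSubmodule R L) :
    NonUnitalModule R (M ⧸ L) where
  smul r := QuotientAddGroup.map L L (DistribSMul.toAddMonoidHom M r) fun x hx => hL r x hx
  smul_zero _ := map_zero _
  smul_add _ := map_add _
  mul_smul r s x := QuotientAddGroup.induction_on x fun x =>
    congrArg (QuotientAddGroup.mk' L) (SemigroupAction.mul_smul r s x)
  add_smul r s x := QuotientAddGroup.induction_on x fun x =>
    congrArg (QuotientAddGroup.mk' L) (NonUnitalModule.add_smul r s x)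

/-- A submodule as a module. -/
abbrev submoduleModule (L : AddSubgroup M) (hL : IsRSubmodule R L) : NonUnitalModule R L where
  smul r x := ⟨r • x.1, hL r x.1 x.2⟩
  smul_zero r := Subtype.ext (smul_zero r)
  smul_add r x y := Subtype.ext (smul_add r x.1 y.1)
  mul_smul r s x := Subtype.ext (SemigroupAction.mul_smul r s x.1)
  add_smul r s x := Subtype.ext (NonUnitalModule.add_smul r s x.1)

end Modules

/-! ### Morphisms, quotients and images of unitary modules -/

namespace UMod

open NonUnitalModule

variable {R : Type u} [NonUnitalRing R] {A B C : UMod R}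

/-- The underlying additive map of a morphism. -/
def toAddHom (f : A ⟶ B) : A.carrier →+ B.carrier := ModHom.toAddMonoidHom f

instance : FunLike (A ⟶ B) A.carrier B.carrier where
  coe f := toAddHom f
  coe_injective _ _ h := ModHom.ext h

instance : AddMonoidHomClass (A ⟶ B) A.carrier B.carrier where
  map_add f := (toAddHom f).map_add
  map_zero f := (toAddHom f).map_zero

theorem hom_ext {f g : A ⟶ B} (h : ∀ x, f x = g x) : f = g := DFunLike.ext f g h

@[simp] theorem hom_smul (f : A ⟶ B) (r : R) (x : A.carrier) : f (r • x) = r • f x :=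
  ModHom.map_smul' f r x

@[simp] theorem id_apply (x : A.carrier) : (𝟙 A : A ⟶ A) x = x := rfl

@[simp] theorem comp_apply (f : A ⟶ B) (g : B ⟶ C) (x : A.carrier) : (f ≫ g) x = g (f x) := rfl

/-- A morphism from a linear additive map. -/
def ofHom (f : A.carrier →+ B.carrier) (hf : ∀ (r : R) x, f (r • x) = r • f x) : A ⟶ B :=
  ModHom.mk f hf

@[simp] theorem ofHom_apply (f : A.carrier →+ B.carrier) (hf : ∀ (r : R) x, f (r • x) = r • f x)
    (x : A.carrier) : ofHom f hf x = f x := rfl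

theorem congr_hom {f g : A ⟶ B} (h : f = g) (x : A.carrier) : f x = g x := h ▸ rfl

/-- The image of a morphism. -/
def range (f : A ⟶ B) : AddSubgroup B.carrier := (toAddHom f).range

theorem mem_range {f : A ⟶ B} {y : B.carrier} : y ∈ range f ↔ ∃ x, f x = y := Iff.rfl

theorem isRSubmodule_range (f : A ⟶ B) : IsRSubmodule R (range f) := by
  rintro r _ ⟨x, rfl⟩
  exact ⟨r • x, hom_smul f r x⟩

/-- The quotient map A → A/L and the zero map agree on L, and A/L is again unitary. This is what
turns epimorphisms into surjections. -/
theorem eq_top_of_forall_hom (L : AddSubgroup A.carrier) (hL : IsRSubmodule R L)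
    (h : ∀ (B : UMod R) (f g : A ⟶ B), (∀ x ∈ L, f x = g x) → f = g) : L = ⊤ := by
  let _ := quotientModule L hL
  let Q : UMod R := ⟨A.carrier ⧸ L, A.unitary.of_surjective (QuotientAddGroup.mk' L)
    (fun _ _ => rfl) (QuotientAddGroup.mk'_surjective L)⟩
  let f : A ⟶ Q := ofHom (QuotientAddGroup.mk' L) fun _ _ => rfl
  let g : A ⟶ Q := ofHom 0 fun r _ => (smul_zero r).symm
  have hfg : f = g := h Q f g fun x hx => (QuotientAddGroup.eq_zero_iff x).2 hx
  exact eq_top_iff.2 fun x _ => (QuotientAddGroup.eq_zero_iff x).1 (congr_hom hfg x)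

theorem surjective_of_epi (f : A ⟶ B) [Epi f] : Function.Surjective f := by
  have h := eq_top_of_forall_hom (range f) (isRSubmodule_range f) fun D g k hgk =>
    (cancel_epi f).1 (hom_ext fun x => hgk _ ⟨x, rfl⟩)
  exact fun y => mem_range.1 (h ▸ trivial : y ∈ range f)

theorem epi_of_surjective (f : A ⟶ B) (hf : Function.Surjective f) : Epi f where
  left_cancellation g h e := hom_ext fun y => by
    obtain ⟨x, rfl⟩ := hf y
    exact congr_hom e x

/-- A bijective morphism is an isomorphism. -/
noncomputable def isoOfBijective (f : A ⟶ B) (hf : Function.Bijective f) : A ≅ B where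
  hom := f
  inv := ofHom ((AddEquiv.ofBijective (toAddHom f) hf).symm : B.carrier →+ A.carrier) fun r y => by
    obtain ⟨x, rfl⟩ := (AddEquiv.ofBijective (toAddHom f) hf).surjective y
    refine (AddEquiv.symm_apply_eq _).2 ?_
    change r • f x = f (r • _)
    rw [hom_smul]
    congr 2
    exact ((AddEquiv.ofBijective (toAddHom f) hf).symm_apply_apply x).symm
  hom_inv_id := hom_ext fun x => (AddEquiv.ofBijective (toAddHom f) hf).symm_apply_apply x
  inv_hom_id := hom_ext fun x => (AddEquiv.ofBijective (toAddHom f) hf).apply_symm_apply x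

/-- The regular module of a ring with local units. -/
def regular (hR : HasLocalUnits R) : UMod R := ⟨R, hR.isUnitaryModule⟩

/-- The image of a morphism as an object. -/
def image (f : A ⟶ B) : UMod R :=
  letI := submoduleModule (range f) (isRSubmodule_range f)
  ⟨range f, A.unitary.of_surjective (toAddHom f).rangeRestrict
    (fun r x => Subtype.ext (hom_smul f r x)) (toAddHom f).rangeRestrict_surjective⟩

/-- The inclusion of the image. -/
def imageι (f : A ⟶ B) : image f ⟶ B := ofHom (range f).subtype fun _ _ => rfl

/-- A morphism, corestricted to its image. -/
def toImage (f : A ⟶ B) : A ⟶ image f :=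
  ofHom (toAddHom f).rangeRestrict fun r x => Subtype.ext (hom_smul f r x)

@[simp] theorem toImage_ι (f : A ⟶ B) : toImage f ≫ imageι f = f := rfl

theorem imageι_injective (f : A ⟶ B) : Function.Injective (imageι f) := Subtype.val_injective

theorem toImage_surjective (f : A ⟶ B) : Function.Surjective (toImage f) :=
  (toAddHom f).rangeRestrict_surjective

/-- The morphism `r ↦ r • x`. -/
def smulRight (hR : HasLocalUnits R) (x : A.carrier) : regular hR ⟶ A :=
  ofHom (A := regular hR) (smulHom R x) fun r s => SemigroupAction.mul_smul r s x

end UMod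

/-! ### Finite generation as a categorical property -/

section JointlyEpi

variable {C : Type (u + 1)} [Category.{u} C] {D : Type (u + 1)} [Category.{u} D]

/-- A family of morphisms with common target is jointly epimorphic. -/
def JointlyEpi {ι : Type u} {N : ι → C} {M : C} (f : ∀ i, N i ⟶ M) : Prop :=
  ∀ ⦃B : C⦄ (g h : M ⟶ B), (∀ i, f i ≫ g = f i ≫ h) → g = h

/-- Every jointly epimorphic family has a finite jointly epimorphic subfamily. -/
def IsFinGenObject (M : C) : Prop :=
  ∀ ⦃ι : Type u⦄ (N : ι → C) (f : ∀ i, N i ⟶ M), JointlyEpi f →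
    ∃ s : Finset ι, JointlyEpi fun i : s => f i

theorem IsFinGenObject.map_equivalence {M : C} (hM : IsFinGenObject M) (e : C ≌ D) :
    IsFinGenObject (e.functor.obj M) := by
  intro ι N f hf
  -- A family into the image of M is tested in the first category, by applying the inverse functor
  -- and identifying the target with M through the unit.
  have key : ∀ {κ : Type u} (K : κ → D) (k : ∀ i, K i ⟶ e.functor.obj M),
      JointlyEpi k ↔ JointlyEpi fun i => e.inverse.map (k i) ≫ e.unitInv.app M := by
    intro κ K k
    constructor
    · intro hk B g h hgh
      apply e.functor.map_injective
      apply hk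
      intro i
      apply e.inverse.map_injective
      have := hgh i
      simpa [e.inv_fun_map] using congrArg (· ≫ e.unit.app B) this
    · intro hk B g h hgh
      apply e.inverse.map_injective
      rw [← cancel_epi (e.unit.app M)]
      apply hk
      intro i
      have := congrArg e.inverse.map (hgh i)
      simpa using this
  obtain ⟨s, hs⟩ := hM _ _ ((key N f).1 hf)
  exact ⟨s, (key _ _).2 hs⟩

end JointlyEpi

namespace UMod

open NonUnitalModule

variable {R : Type u} [NonUnitalRing R]

theorem isRSubmodule_iSup {M : Type u} [AddCommGroup M] [NonUnitalModule R M] {ι : Sort*}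
    (L : ι → AddSubgroup M) (hL : ∀ i, IsRSubmodule R (L i)) : IsRSubmodule R (⨆ i, L i) := by
  intro r x hx
  induction hx using AddSubgroup.iSup_induction' with
  | hp i x hx => exact AddSubgroup.mem_iSup_of_mem i (hL i r x hx)
  | h1 => rw [smul_zero]; exact zero_mem _
  | hadd x y _ _ ihx ihy => rw [smul_add]; exact add_mem ihx ihy

theorem jointlyEpi_iff {ι : Type u} {N : ι → UMod R} {M : UMod R} (f : ∀ i, N i ⟶ M) :
    JointlyEpi f ↔ ⨆ i, range (f i) = ⊤ := by
  constructor
  · intro hf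
    refine eq_top_of_forall_hom _ (isRSubmodule_iSup _ fun i => isRSubmodule_range (f i))
      fun B g h hgh => hf g h fun i => hom_ext fun x => hgh _ ?_
    exact AddSubgroup.mem_iSup_of_mem i ⟨x, rfl⟩
  · intro hf B g h hgh
    have : ⨆ i, range (f i) ≤ (toAddHom g).eqLocus (toAddHom h) :=
      iSup_le fun i => by
        rintro _ ⟨x, rfl⟩
        exact congr_hom (hgh i) x
    exact hom_ext fun x => this (hf ▸ trivial)

/-- Each of finitely many generators lies in a sum of finitely many images. Conversely, the maps r ↦
rx for x ∈ M are jointly epimorphic since M is unitary, and a finite subfamily names generators. -/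
theorem isFG_iff_isFinGenObject (hR : HasLocalUnits R) (M : UMod R) :
    M.IsFG ↔ IsFinGenObject M := by
  classical
  constructor
  · rintro ⟨-, X, -, hX⟩ ι N f hf
    rw [jointlyEpi_iff] at hf
    have key : ∀ x : M.carrier, ∃ s : Finset ι, x ∈ ⨆ i : s, range (f i) := by
      intro x
      have hx : x ∈ ⨆ i, range (f i) := hf ▸ trivial
      induction hx using AddSubgroup.iSup_induction' with
      | hp i x hx => exact ⟨{i}, AddSubgroup.mem_iSup_of_mem ⟨i, by simp⟩ hx⟩
      | h1 => exact ⟨∅, zero_mem _⟩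
      | hadd x y _ _ ihx ihy =>
        obtain ⟨s, hs⟩ := ihx
        obtain ⟨t, ht⟩ := ihy
        refine ⟨s ∪ t, add_mem ?_ ?_⟩
        · exact iSup_le (fun i : s => le_iSup (fun i : ↥(s ∪ t) => range (f i))
            ⟨i, Finset.mem_union_left _ i.2⟩) hs
        · exact iSup_le (fun i : t => le_iSup (fun i : ↥(s ∪ t) => range (f i))
            ⟨i, Finset.mem_union_right _ i.2⟩) ht
    choose s hs using key
    refine ⟨X.biUnion s, (jointlyEpi_iff _).2 (eq_top_iff.2 (hX _ ?_ ?_))⟩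
    · exact isRSubmodule_iSup _ fun i => isRSubmodule_range _
    · intro x hx
      exact iSup_le (fun i : s x => le_iSup (fun i : ↥(X.biUnion s) => range (f i))
        ⟨i, Finset.mem_biUnion.2 ⟨x, hx, i.2⟩⟩) (hs x)
  · intro hM
    have hf : JointlyEpi fun x : M.carrier => smulRight hR x := by
      refine (jointlyEpi_iff _).2 (eq_top_iff.2 fun x _ => AddSubgroup.mem_iSup_of_mem x ?_)
      obtain ⟨r, hr⟩ := M.unitary.exists_smul_eq hR x
      exact ⟨r, hr⟩
    obtain ⟨s, hs⟩ := hM _ _ hf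
    rw [jointlyEpi_iff] at hs
    refine ⟨fun _ _ _ => trivial, s, fun _ _ => trivial, fun K hK hsK => hs ▸ iSup_le ?_⟩
    rintro ⟨x, hx⟩ _ ⟨r, rfl⟩
    exact hK r x (hsK hx)

theorem IsFG.map_equivalence {S : Type u} [NonUnitalRing S] (hR : HasLocalUnits R)
    (hS : HasLocalUnits S) {M : UMod R} (hM : M.IsFG) (e : UMod R ≌ UMod S) :
    (e.functor.obj M).IsFG :=
  (isFG_iff_isFinGenObject hS _).2 (((isFG_iff_isFinGenObject hR M).1 hM).map_equivalence e)

theorem IsLocallyProjectiveGenerator.map_equivalence {S : Type u} [NonUnitalRing S]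
    (hR : HasLocalUnits R) (hS : HasLocalUnits S) {M : UMod R}
    (hM : M.IsLocallyProjectiveGenerator) (e : UMod R ≌ UMod S) :
    (e.functor.obj M).IsLocallyProjectiveGenerator := by
  refine ⟨?_, hM.2.of_equivalence e⟩
  obtain ⟨I, _, _, _, F, ⟨ψ, hψ₁, hψ₂⟩, hF, c, ⟨hc⟩, ⟨i⟩⟩ := hM.1
  refine ⟨I, inferInstance, inferInstance, inferInstance, F ⋙ e.functor,
    ⟨fun i j h => e.functor.map (ψ i j h), fun i j h => ?_, fun i j k h h' => ?_⟩,
    fun i => ⟨(hF i).1.map_equivalence hR hS e, ?_⟩,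
    e.functor.mapCocone c, ⟨isColimitOfPreserves e.functor hc⟩, ⟨e.functor.mapIso i⟩⟩
  · rw [Functor.comp_map, ← e.functor.map_comp, hψ₁]
    exact e.functor.map_id _
  · rw [← e.functor.map_comp, hψ₂]
  · exact (e.map_projective_iff _).2 (hF i).2

/-! ### Dual bases -/

/-- The additive map underlying a functional. -/
def coeff {hR : HasLocalUnits R} {M : UMod R} (a : M ⟶ regular hR) : M.carrier →+ R := toAddHom a

theorem coeff_smul {hR : HasLocalUnits R} {M : UMod R} (a : M ⟶ regular hR) (r : R)
    (x : M.carrier) : coeff a (r • x) = r * coeff a x := hom_smul a r x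

theorem hom_sum_smul {M N : UMod R} {ι : Type u} [Fintype ι] (f : M ⟶ N) (r : ι → R)
    (p : ι → M.carrier) : f (∑ j, r j • p j) = ∑ j, r j • f (p j) := by
  rw [map_sum]
  simp_rw [hom_smul]

/-- `(a, p)` is a dual basis for the endomorphism `π` of `M` if `π x = ∑ a_j(x) p_j`. -/
def IsDualBasis (hR : HasLocalUnits R) {M : UMod R} {ι : Type u} [Fintype ι] (π : M ⟶ M)
    (a : ι → (M ⟶ regular hR)) (p : ι → M.carrier) : Prop :=
  ∀ x, ∑ j, coeff (a j) x • p j = π x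

/-- To lift f along g, choose preimages b_j of f(p_j) and send x to ∑ a_j(x)b_j. -/
theorem IsDualBasis.projective {hR : HasLocalUnits R} {M : UMod R} {ι : Type u} [Fintype ι]
    {a : ι → (M ⟶ regular hR)} {p : ι → M.carrier} (h : IsDualBasis hR (𝟙 M) a p) :
    Projective M where
  factors {B A} f g _ := by
    choose b hb using fun j => surjective_of_epi g (f (p j))
    let l : M.carrier →+ B.carrier :=
      ∑ j, (smulHom R (b j)).comp (coeff (a j))
    have hl : ∀ x, l x = ∑ j, coeff (a j) x • b j := fun x => by
      rw [AddMonoidHom.finsetSum_apply]; rfl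
    refine ⟨ofHom l fun r x => ?_, hom_ext fun x => ?_⟩
    · rw [hl, hl, smul_sum']
      refine Finset.sum_congr rfl fun j _ => ?_
      rw [← SemigroupAction.mul_smul, coeff_smul]
    · rw [comp_apply, ofHom_apply, hl, hom_sum_smul]
      simp_rw [hb]
      rw [← hom_sum_smul, h x, id_apply]

theorem IsDualBasis.isFG {hR : HasLocalUnits R} {M : UMod R} {ι : Type u} [Fintype ι]
    {a : ι → (M ⟶ regular hR)} {p : ι → M.carrier} (h : IsDualBasis hR (𝟙 M) a p) :
    M.IsFG := by
  classical
  refine ⟨fun _ _ _ => trivial, Finset.univ.image p, fun _ _ => trivial, fun K hK hp x _ => ?_⟩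
  have hx : ∑ j, coeff (a j) x • p j = x := h x
  rw [← hx]
  exact sum_mem fun j _ => hK _ _ (hp (by simp))

/-- For a finite generating set X, the map R^X → M is onto even without an identity in R.
Projectivity splits it, and the coordinates of the section are the functionals. -/
theorem exists_isDualBasis (hR : HasLocalUnits R) {M : UMod R} (hM : M.IsFG)
    (hP : Projective M) : ∃ (ι : Type u) (_ : Fintype ι) (a : ι → (M ⟶ regular hR))
      (p : ι → M.carrier), IsDualBasis hR (𝟙 M) a p := by
  obtain ⟨-, X, -, hX⟩ := hM
  obtain ⟨e, -, he⟩ := M.unitary.exists_idempotent hR X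
  have hu : IsUnitaryModule R (X → R) := by
    classical
    refine isUnitaryModule_of_forall fun x => ?_
    obtain ⟨e, -, he⟩ := hR.exists_mul (Finset.univ.image x)
    exact ⟨e, funext fun i => (he (x i) (by simp)).1⟩
  let T : UMod R := ⟨X → R, hu⟩
  let g₀ : T.carrier →+ M.carrier :=
    ∑ j : X, (smulHom R (j : M.carrier)).comp (Pi.evalAddMonoidHom (fun _ : X => R) j)
  have hg₀ : ∀ x : X → R, g₀ x = ∑ j : X, x j • (j : M.carrier) := fun x => by
    rw [AddMonoidHom.finsetSum_apply]; rfl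
  let g : T ⟶ M := ofHom g₀ fun r (x : X → R) => by
    refine (hg₀ (r • x)).trans ?_
    rw [hg₀, smul_sum']
    exact Finset.sum_congr rfl fun j _ => SemigroupAction.mul_smul r (x j) _
  have : Epi g := epi_of_surjective g fun y => by
    classical
    refine hX (range g) (isRSubmodule_range g) (fun x hx => ?_) (trivial : y ∈ ⊤)
    -- The idempotent e fixes all of X, so it serves as the missing 1.
    refine ⟨Pi.single (⟨x, hx⟩ : X) e, (hg₀ _).trans ?_⟩
    rw [Finset.sum_eq_single (⟨x, hx⟩ : X)]
    · rw [Pi.single_eq_same]; exact he x hx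
    · intro b _ hb
      rw [Pi.single_eq_of_ne hb, zero_smul']
    · simp
  obtain ⟨l, hl⟩ := Projective.factors (𝟙 M) g
  refine ⟨X, inferInstance, fun j => ofHom
    ((Pi.evalAddMonoidHom (fun _ : X => R) j).comp (toAddHom l)) fun r x => ?_,
    fun j => j, fun x => ?_⟩
  · exact congrFun (hom_smul l r x) j
  · exact (hg₀ (l x)).symm.trans (congr_hom hl x)

/-! ### Split direct systems -/

section SplitSystem

variable {I : Type u} [Preorder I]

/-- The system of images of a compatible family of endomorphisms. -/
def imageSystem {M : UMod R} (π : I → (M ⟶ M))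
    (h : ∀ i j, i ≤ j → π i ≫ π j = π i) : I ⥤ UMod R where
  obj i := image (π i)
  map {i j} _ := imageι (π i) ≫ toImage (π j)
  map_id i := hom_ext fun ⟨x, hx⟩ => by
    obtain ⟨y, rfl⟩ := hx
    exact Subtype.ext (congr_hom (h i i le_rfl) y)
  map_comp {i j k} f g := hom_ext fun ⟨x, hx⟩ => by
    obtain ⟨y, rfl⟩ := hx
    refine Subtype.ext ?_
    change π k (π i y) = π k (π j (π i y))
    rw [← comp_apply (π i) (π j), h i j (leOfHom f)]

/-- M is the directed union of the images of the π_i, which are idempotent by `h₁` at i = j. The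
transition maps are inclusions and π_i is the retraction onto the i-th image; `h₂` makes these
retractions compatible. -/
theorem isLocallyProjective_of_idempotents [IsDirectedOrder I] [Nonempty I]
    (hR : HasLocalUnits R) {M : UMod R} (π : I → (M ⟶ M))
    (h₁ : ∀ i j, i ≤ j → π i ≫ π j = π i) (h₂ : ∀ i j, i ≤ j → π j ≫ π i = π i)
    (hM : ∀ x, ∃ i, π i x = x)
    (hd : ∀ i, ∃ (ι : Type u) (_ : Fintype ι) (a : ι → (M ⟶ regular hR)) (p : ι → M.carrier),
      IsDualBasis hR (π i) a p) : M.IsLocallyProjective := by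
  let c : Cocone (imageSystem π h₁) :=
    { pt := M
      ι := { app := fun i => imageι (π i)
             naturality := fun i j f => hom_ext fun ⟨x, hx⟩ => by
              obtain ⟨y, rfl⟩ := hx
              exact congr_hom (h₁ i j (leOfHom f)) y } }
  have hfix : ∀ i j, i ≤ j → ∀ x, π i x = x → π j x = x := fun i j hij x hx => by
    have := congr_hom (h₁ i j hij) x
    rwa [comp_apply, hx] at this
  have hmem : ∀ i x, π i x = x → x ∈ range (π i) := fun i x hx => ⟨x, hx⟩
  have hc : IsColimit c := by
    -- The value of a cocone at x does not depend on the image in which x is placed. This makes the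
    -- descent map well defined and linear.
    have hwd : ∀ (s : Cocone (imageSystem π h₁)) (i j : I) (hij : i ≤ j) (x : M.carrier)
        (hx : π i x = x) (hx' : π j x = x),
        s.ι.app i ⟨x, hmem i x hx⟩ = s.ι.app j ⟨x, hmem j x hx'⟩ := by
      intro s i j hij x hx hx'
      rw [← s.w (homOfLE hij)]
      exact congrArg (s.ι.app j) (Subtype.ext hx')
    have hwd' : ∀ (s : Cocone (imageSystem π h₁)) (i j : I) (x : M.carrier)
        (hx : π i x = x) (hx' : π j x = x),
        s.ι.app i ⟨x, hmem i x hx⟩ = s.ι.app j ⟨x, hmem j x hx'⟩ := by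
      intro s i j x hx hx'
      obtain ⟨k, hik, hjk⟩ := exists_ge_ge i j
      rw [hwd s i k hik x hx (hfix i k hik x hx), hwd s j k hjk x hx' (hfix i k hik x hx)]
    choose i hi using hM
    let d : ∀ s : Cocone (imageSystem π h₁), M ⟶ s.pt := fun s =>
      ofHom (AddMonoidHom.mk' (fun x => s.ι.app (i x) ⟨x, hmem (i x) x (hi x)⟩) (by
        intro x y
        obtain ⟨k, hk, hk'⟩ := exists_ge_ge (i x) (i y)
        have hx := hfix _ k hk x (hi x)
        have hy := hfix _ k hk' y (hi y)
        rw [hwd' s _ k x (hi x) hx, hwd' s _ k y (hi y) hy]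
        have hxy : π k (x + y) = x + y := by rw [map_add, hx, hy]
        exact (hwd' s _ k (x + y) (hi _) hxy).trans
          (map_add (s.ι.app k) ⟨x, hmem k x hx⟩ ⟨y, hmem k y hy⟩))) (by
        intro r x
        have hx : π (i x) (r • x) = r • x := by rw [hom_smul, hi x]
        exact (hwd' s _ (i x) (r • x) (hi _) hx).trans
          (hom_smul (s.ι.app (i x)) r ⟨x, hmem (i x) x (hi x)⟩))
    refine { desc := d, fac := fun s j => hom_ext fun ⟨x, hx⟩ => ?_,
             uniq := fun s m hm => hom_ext fun x => ?_ }
    · refine hwd' s _ j x (hi x) ?_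
      obtain ⟨y, rfl⟩ := hx
      exact congr_hom (h₁ j j le_rfl) y
    · change m x = s.ι.app _ _
      rw [← hm (i x)]
      rfl
  refine ⟨I, inferInstance, inferInstance, inferInstance, imageSystem π h₁,
    ⟨fun i j _ => imageι (π j) ≫ toImage (π i), ?_, ?_⟩, ?_, c, ⟨hc⟩, ⟨Iso.refl M⟩⟩
  · intro i j h
    refine hom_ext fun ⟨x, hx⟩ => Subtype.ext ?_
    obtain ⟨y, rfl⟩ := hx
    change π i (π j (π i y)) = π i y
    rw [← comp_apply (π i) (π j), h₁ i j h]
    exact congr_hom (h₁ i i le_rfl) y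
  · intro i j k h h'
    refine hom_ext fun ⟨x, hx⟩ => Subtype.ext ?_
    exact congr_hom (h₂ i j h) x
  · intro i
    obtain ⟨ι, _, a, p, hap⟩ := hd i
    -- A dual basis for π_i on M yields one for its image: restrict the functionals and project the
    -- vectors.
    have : IsDualBasis hR (𝟙 (image (π i))) (fun j => imageι (π i) ≫ a j)
        (fun j => toImage (π i) (p j)) := by
      intro x
      apply imageι_injective
      rw [hom_sum_smul]
      obtain ⟨y, rfl⟩ := toImage_surjective _ x
      have h3 := congrArg (π i) (hap (π i y))
      rw [hom_sum_smul] at h3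
      refine h3.trans ?_
      have h4 := congr_hom (h₁ i i le_rfl)
      exact (h4 _).trans (h4 y)
    exact ⟨this.isFG, this.projective⟩

/-- The canonical maps into the direct limit of a split system have retractions. -/
theorem exists_retraction_of_split {C : Type (u + 1)} [Category.{u} C] [IsDirectedOrder I]
    {F : I ⥤ C} {c : Cocone F} (hc : IsColimit c)
    (ψ : ∀ i j : I, i ≤ j → (F.obj j ⟶ F.obj i))
    (hψ₁ : ∀ (i j : I) (h : i ≤ j), F.map (homOfLE h) ≫ ψ i j h = 𝟙 (F.obj i))
    (hψ₂ : ∀ (i j k : I) (h : i ≤ j) (h' : j ≤ k), ψ j k h' ≫ ψ i j h = ψ i k (h.trans h'))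
    (i : I) : ∃ ρ : c.pt ⟶ F.obj i, c.ι.app i ≫ ρ = 𝟙 (F.obj i) := by
  choose k hk hk' using fun j => exists_ge_ge i j
  -- On F_j the retraction goes up to a common bound of i and j and comes back by ψ. The result does
  -- not depend on the bound.
  have hind : ∀ (j l m : I) (hl : j ≤ l) (hl' : i ≤ l) (hm : l ≤ m),
      F.map (homOfLE hl) ≫ ψ i l hl' = F.map (homOfLE (hl.trans hm)) ≫ ψ i m (hl'.trans hm) := by
    intro j l m hl hl' hm
    rw [← hψ₂ i l m hl' hm, ← homOfLE_comp hl hm, F.map_comp, Category.assoc,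
      reassoc_of% (hψ₁ l m hm)]
  have hind' : ∀ (j l m : I) (hl : j ≤ l) (hl' : i ≤ l) (hm : j ≤ m) (hm' : i ≤ m),
      F.map (homOfLE hl) ≫ ψ i l hl' = F.map (homOfLE hm) ≫ ψ i m hm' := by
    intro j l m hl hl' hm hm'
    obtain ⟨n, hn, hn'⟩ := exists_ge_ge l m
    rw [hind j l n hl hl' hn, hind j m n hm hm' hn']
  let s : Cocone F :=
    { pt := F.obj i
      ι := { app := fun j => F.map (homOfLE (hk' j)) ≫ ψ i (k j) (hk j)
             naturality := fun j l f => by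
              rw [← Category.assoc, ← F.map_comp]
              exact (hind' j (k l) (k j) _ _ _ _).trans (Category.comp_id _).symm } }
  refine ⟨hc.desc s, ?_⟩
  rw [hc.fac]
  exact hψ₁ i _ _

end SplitSystem

/-- Finitely many elements of a locally projective module have a common dual basis. -/
theorem IsLocallyProjective.exists_dualBasis (hR : HasLocalUnits R) {M : UMod R}
    (hM : M.IsLocallyProjective) (X : Finset M.carrier) :
    ∃ (ι : Type u) (_ : Fintype ι) (a : ι → (M ⟶ regular hR)) (p : ι → M.carrier),
      ∀ x ∈ X, ∑ j, coeff (a j) x • p j = x := by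
  classical
  obtain ⟨I, _, _, _, F, ⟨ψ, hψ₁, hψ₂⟩, hF, c, ⟨hc⟩, ⟨e⟩⟩ := hM
  let φ : ∀ i, F.obj i ⟶ M := fun i => c.ι.app i ≫ e.hom
  have hφ : ∀ i j, i ≤ j → range (φ i) ≤ range (φ j) := by
    rintro i j hij _ ⟨x, rfl⟩
    refine ⟨F.map (homOfLE hij) x, ?_⟩
    change φ j (F.map (homOfLE hij) x) = φ i x
    rw [← comp_apply, ← Category.assoc, c.w]
  have htop : ⨆ i, range (φ i) = ⊤ := by
    refine (jointlyEpi_iff φ).1 fun B g h hgh => ?_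
    rw [← cancel_epi e.hom]
    exact hc.hom_ext fun j => by simpa [φ] using hgh j
  have hex : ∀ x, ∃ i, x ∈ range (φ i) := fun x =>
    (AddSubgroup.mem_iSup_of_directed fun i j => by
      obtain ⟨k, hk, hk'⟩ := exists_ge_ge i j
      exact ⟨k, hφ _ _ hk, hφ _ _ hk'⟩).1 (htop ▸ trivial : x ∈ ⨆ i, range (φ i))
  choose i hi using hex
  -- By directedness X lies in the image of a single F_k. The retraction onto F_k extends the
  -- functionals of its dual basis to M.
  obtain ⟨k, hk⟩ := (X.image i).exists_le
  obtain ⟨ρ, hρ⟩ := exists_retraction_of_split hc ψ hψ₁ hψ₂ k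
  obtain ⟨ι, _, a, p, hap⟩ := exists_isDualBasis hR (hF k).1 (hF k).2
  refine ⟨ι, inferInstance, fun j => e.inv ≫ ρ ≫ a j, fun j => φ k (p j), fun x hx => ?_⟩
  obtain ⟨y, rfl⟩ := hφ _ _ (hk (i x) (Finset.mem_image_of_mem i hx)) (hi x)
  have h1 : φ k ≫ e.inv ≫ ρ = 𝟙 _ := by simp [φ, hρ]
  have h2 := congrArg (φ k) (hap y)
  rw [hom_sum_smul] at h2
  refine Eq.trans (Finset.sum_congr rfl fun j _ => ?_) h2
  exact congrArg (fun t => coeff (a j) t • φ k (p j)) (congr_hom h1 y)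

end UMod

/-- Idempotents of a ring, with `e ≤ f` if `ef = fe = e`. -/
structure IdempotentIndex (R : Type u) [NonUnitalRing R] where
  val : R
  mul_self : val * val = val

namespace IdempotentIndex

variable {R : Type u} [NonUnitalRing R]

instance : Preorder (IdempotentIndex R) where
  le e f := e.val * f.val = e.val ∧ f.val * e.val = e.val
  le_refl e := ⟨e.mul_self, e.mul_self⟩
  le_trans e f g h h' :=
    ⟨by rw [← h.1, mul_assoc, h'.1], by rw [← h.2, ← mul_assoc, h'.2]⟩

instance : Nonempty (IdempotentIndex R) := ⟨⟨0, mul_zero 0⟩⟩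

theorem isDirectedOrder (hR : HasLocalUnits R) : IsDirectedOrder (IdempotentIndex R) where
  directed e f := by
    classical
    obtain ⟨g, hg, h⟩ := hR.exists_mul {e.val, f.val}
    exact ⟨⟨g, hg⟩, (h e.val (by simp)).symm, (h f.val (by simp)).symm⟩

end IdempotentIndex

/-! ### The regular module -/

namespace UMod

open NonUnitalModule

variable {R : Type u} [NonUnitalRing R]

/-- R is the directed union of the Re, e idempotent. Right multiplication by e has the one-element
dual basis given by the identity functional and e. -/
theorem isLocallyProjectiveGenerator_regular (hR : HasLocalUnits R) :
    (regular hR).IsLocallyProjectiveGenerator := by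
  constructor
  · have := IdempotentIndex.isDirectedOrder hR
    refine isLocallyProjective_of_idempotents (I := IdempotentIndex R) hR
      (fun e => smulRight (A := regular hR) hR e.val) (fun e f h => ?_) (fun e f h => ?_)
      (fun (x : R) => ?_) fun e => ?_
    · exact hom_ext fun (x : R) => (mul_assoc x e.val f.val).trans (congrArg (x * ·) h.1)
    · exact hom_ext fun (x : R) => (mul_assoc x f.val e.val).trans (congrArg (x * ·) h.2)
    · obtain ⟨e, he, h⟩ := hR.exists_mul {x}
      exact ⟨⟨e, he⟩, (h x (by simp)).2⟩
    · exact ⟨PUnit, inferInstance, fun _ => 𝟙 _, fun _ => e.val, fun x => by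
        rw [Fintype.sum_unique]; rfl⟩
  · refine (isSeparator_def _).2 fun M B f g h => hom_ext fun x => ?_
    obtain ⟨r, hr⟩ := M.unitary.exists_smul_eq hR x
    have := congr_hom (h (smulRight hR x)) r
    have hx : smulRight hR x r = x := hr
    change f (smulRight hR x r) = g (smulRight hR x r) at this
    rwa [hx] at this

end UMod

open NonUnitalModule

/-! ### The unitary part of Hom as a functor -/

section HomFunctor

variable {R S : Type u} [NonUnitalRing R] [NonUnitalRing S] (hR : HasLocalUnits R)
  (hS : HasLocalUnits S)

/-- The `R`-linear maps `h : P → M` such that `h(x s) = h(x)` for some `s ∈ S`; this is the largest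
unitary submodule of the left `S`-module `Hom_R(P, M)`. -/
def unitaryHom (R P M : Type u) [NonUnitalRing R] [AddCommGroup P] [AddCommGroup M]
    [NonUnitalModule R P] [NonUnitalModule Sᵐᵒᵖ P] [NonUnitalModule R M] :
    AddSubgroup (P →+ M) where
  carrier := {h | (∀ (r : R) x, h (r • x) = r • h x) ∧
    ∃ s : S, ∀ x, h (MulOpposite.op s • x) = h x}
  zero_mem' := ⟨fun r _ => (smul_zero r).symm, 0, fun _ => rfl⟩
  neg_mem' {h} hh := ⟨fun r x => by
    rw [AddMonoidHom.neg_apply, AddMonoidHom.neg_apply, hh.1, smul_neg'], hh.2.imp fun s hs x => by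
    rw [AddMonoidHom.neg_apply, AddMonoidHom.neg_apply, hs]⟩
  add_mem' {h k} hh hk := by
    classical
    refine ⟨fun r x => ?_, ?_⟩
    · rw [AddMonoidHom.add_apply, AddMonoidHom.add_apply, hh.1, hk.1, smul_add]
    · obtain ⟨s, hs⟩ := hh.2
      obtain ⟨t, ht⟩ := hk.2
      obtain ⟨e, -, he⟩ := hS.exists_mul {s, t}
      refine ⟨e, fun x => ?_⟩
      rw [AddMonoidHom.add_apply, AddMonoidHom.add_apply]
      congr 1
      · rw [← hs (_ • x), ← SemigroupAction.mul_smul, ← MulOpposite.op_mul, (he s (by simp)).1, hs]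
      · rw [← ht (_ • x), ← SemigroupAction.mul_smul, ← MulOpposite.op_mul, (he t (by simp)).1, ht]

variable {P M : Type u} [AddCommGroup P] [AddCommGroup M]
  [NonUnitalModule R P] [NonUnitalModule Sᵐᵒᵖ P] [SMulCommClass R Sᵐᵒᵖ P] [NonUnitalModule R M]

/-- The left `S`-module structure `(s h)(x) = h(x s)`. -/
instance unitaryHomModule : NonUnitalModule S (unitaryHom hS R P M) where
  smul s h := ⟨h.1.comp (DistribSMul.toAddMonoidHom P (MulOpposite.op s)), fun r x => by
      change h.1 (MulOpposite.op s • r • x) = r • h.1 (MulOpposite.op s • x)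
      rw [← h.2.1, smul_comm r (MulOpposite.op s) x], by
      obtain ⟨e, -, he⟩ := hS.exists_mul {s}
      refine ⟨e, fun x => ?_⟩
      change h.1 (MulOpposite.op s • MulOpposite.op e • x) = h.1 (MulOpposite.op s • x)
      rw [← SemigroupAction.mul_smul, ← MulOpposite.op_mul, (he s (by simp)).1]⟩
  smul_zero _ := rfl
  smul_add _ _ _ := rfl
  mul_smul s t h := Subtype.ext (AddMonoidHom.ext fun x =>
    congrArg h.1 (SemigroupAction.mul_smul (MulOpposite.op t) (MulOpposite.op s) x))
  add_smul s t h := Subtype.ext (AddMonoidHom.ext fun x =>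
    (congrArg h.1 (NonUnitalModule.add_smul (MulOpposite.op s) (MulOpposite.op t) x)).trans
      (map_add h.1 _ _))

theorem unitaryHom_smul_apply (s : S) (h : unitaryHom hS R P M) (x : P) :
    (s • h).1 x = h.1 (MulOpposite.op s • x) := rfl

theorem unitaryHom_isUnitary : IsUnitaryModule S (unitaryHom hS R P M) :=
  isUnitaryModule_of_forall fun h => by
    obtain ⟨s, hs⟩ := h.2.2
    exact ⟨s, Subtype.ext (AddMonoidHom.ext hs)⟩

variable (P) in
/-- The functor `M ↦ S Hom_R(P, M)`. -/
def homFunctor : UMod R ⥤ UMod S where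
  obj M := ⟨unitaryHom hS R P M.carrier, unitaryHom_isUnitary hS⟩
  map {M N} f := UMod.ofHom
    (A := ⟨unitaryHom hS R P M.carrier, unitaryHom_isUnitary hS⟩)
    (B := ⟨unitaryHom hS R P N.carrier, unitaryHom_isUnitary hS⟩)
    (AddMonoidHom.mk' (fun h => ⟨(UMod.toAddHom f).comp h.1, fun r x => by
        change f (h.1 (r • x)) = r • f (h.1 x)
        rw [h.2.1, UMod.hom_smul], h.2.2.imp fun s hs x => congrArg f (hs x)⟩)
      fun h k => Subtype.ext (AddMonoidHom.ext fun x => map_add f (h.1 x) (k.1 x)))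
    fun _ _ => rfl

end HomFunctor

/-! ### Surjective Morita contexts give equivalences -/

/-- A Morita context with surjective pairings `P × Q → R` and `Q × P → S`. -/
structure SurjectiveMoritaContext (R S P Q : Type u) [NonUnitalRing R] [NonUnitalRing S]
    [AddCommGroup P] [AddCommGroup Q] [NonUnitalModule R P] [NonUnitalModule Sᵐᵒᵖ P]
    [NonUnitalModule S Q] [NonUnitalModule Rᵐᵒᵖ Q] where
  pq : P →+ Q →+ R
  qp : Q →+ P →+ S
  pq_smul_left : ∀ (r : R) p q, pq (r • p) q = r * pq p q
  pq_smul_right : ∀ (r : R) p q, pq p (MulOpposite.op r • q) = pq p q * r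
  pq_balanced : ∀ (s : S) p q, pq (MulOpposite.op s • p) q = pq p (s • q)
  qp_smul_left : ∀ (s : S) q p, qp (s • q) p = s * qp q p
  qp_smul_right : ∀ (s : S) q p, qp q (MulOpposite.op s • p) = qp q p * s
  qp_balanced : ∀ (r : R) q p, qp (MulOpposite.op r • q) p = qp q (r • p)
  pq_smul : ∀ p q p', pq p q • p' = MulOpposite.op (qp q p') • p
  qp_smul : ∀ q p q', qp q p • q' = MulOpposite.op (pq p q') • q
  exists_pq : ∀ r : R, ∃ (ι : Type u) (_ : Fintype ι) (p : ι → P) (q : ι → Q),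
    ∑ j, pq (p j) (q j) = r
  exists_qp : ∀ s : S, ∃ (ι : Type u) (_ : Fintype ι) (q : ι → Q) (p : ι → P),
    ∑ j, qp (q j) (p j) = s

namespace SurjectiveMoritaContext

variable {R S P Q : Type u} [NonUnitalRing R] [NonUnitalRing S]
    [AddCommGroup P] [AddCommGroup Q] [NonUnitalModule R P] [NonUnitalModule Sᵐᵒᵖ P]
    [NonUnitalModule S Q] [NonUnitalModule Rᵐᵒᵖ Q]

/-- Interchanging the roles of the two rings. -/
def swap (c : SurjectiveMoritaContext R S P Q) : SurjectiveMoritaContext S R Q P where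
  pq := c.qp
  qp := c.pq
  pq_smul_left := c.qp_smul_left
  pq_smul_right := c.qp_smul_right
  pq_balanced := c.qp_balanced
  qp_smul_left := c.pq_smul_left
  qp_smul_right := c.pq_smul_right
  qp_balanced := c.pq_balanced
  pq_smul := c.qp_smul
  qp_smul := c.pq_smul
  exists_pq := c.exists_qp
  exists_qp := c.exists_pq

variable (c : SurjectiveMoritaContext R S P Q) (hR : HasLocalUnits R) (hS : HasLocalUnits S)
  (hP : IsUnitaryModule R P) (hQ : IsUnitaryModule S Q)

include c hR in
-- Write a local unit e of r as ∑ (p_j, q_j); then r = re = ∑ (rp_j, q_j).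
theorem smul_injective (r : R) (h : ∀ x : P, r • x = 0) : r = 0 := by
  obtain ⟨e, -, he⟩ := hR.exists_mul {r}
  obtain ⟨ι, _, p, q, hpq⟩ := c.exists_pq e
  rw [← (he r (by simp)).2, ← hpq, Finset.mul_sum]
  refine Finset.sum_eq_zero fun j _ => ?_
  rw [← c.pq_smul_left, h, map_zero, AddMonoidHom.zero_apply]

section Unit

variable {M : Type u} [AddCommGroup M] [NonUnitalModule R M]

/-- The map `x ↦ (x, q) m`. -/
def act (m : M) (q : Q) : unitaryHom hS R P M :=
  ⟨(smulHom R m).comp (c.pq.flip q), fun r x => by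
    change c.pq (r • x) q • m = r • c.pq x q • m
    rw [c.pq_smul_left, SemigroupAction.mul_smul], by
    obtain ⟨s, hs⟩ := hQ.exists_smul_eq hS q
    refine ⟨s, fun x => ?_⟩
    change c.pq (MulOpposite.op s • x) q • m = c.pq x q • m
    rw [c.pq_balanced, hs]⟩

variable [SMulCommClass R Sᵐᵒᵖ P]

/-- The unit of the adjoint equivalence on a unitary module. -/
def unitHom (hM : IsUnitaryModule R M) : M →+ unitaryHom hR S Q (unitaryHom hS R P M) :=
  AddMonoidHom.mk' (fun m => ⟨AddMonoidHom.mk' (c.act hS hQ m) fun q q' =>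
      Subtype.ext (AddMonoidHom.ext fun x => by
        change c.pq x (q + q') • m = c.pq x q • m + c.pq x q' • m
        rw [map_add, NonUnitalModule.add_smul]), fun s q =>
      Subtype.ext (AddMonoidHom.ext fun x => by
        change c.pq x (s • q) • m = c.pq (MulOpposite.op s • x) q • m
        rw [c.pq_balanced]), by
      obtain ⟨r, hr⟩ := hM.exists_smul_eq hR m
      refine ⟨r, fun q => Subtype.ext (AddMonoidHom.ext fun x => ?_)⟩
      change c.pq x (MulOpposite.op r • q) • m = c.pq x q • m
      rw [c.pq_smul_right, SemigroupAction.mul_smul, hr]⟩)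
    fun m m' => Subtype.ext (AddMonoidHom.ext fun q => Subtype.ext (AddMonoidHom.ext fun x =>
      smul_add (c.pq x q) m m'))

theorem unitHom_apply (hM : IsUnitaryModule R M) (m : M) (q : Q) (x : P) :
    ((c.unitHom hR hS hQ hM m).1 q).1 x = c.pq x q • m := rfl

theorem unitHom_bijective (hM : IsUnitaryModule R M) :
    Function.Bijective (c.unitHom hR hS hQ hM) := by
  constructor
  · refine (injective_iff_map_eq_zero _).2 fun m hm => ?_
    obtain ⟨r, hr⟩ := hM.exists_smul_eq hR m
    obtain ⟨ι, _, p, q, hpq⟩ := c.exists_pq r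
    rw [← hr, ← hpq, sum_smul']
    refine Finset.sum_eq_zero fun j _ => ?_
    rw [← c.unitHom_apply hR hS hQ hM, hm]
    rfl
  · intro k
    obtain ⟨e, he⟩ := k.2.2
    obtain ⟨ι, _, p, q, hpq⟩ := c.exists_pq e
    -- Since k(te) = k(t) and te = ∑ [t, p_j]q_j, the S-linearity of k expresses k through its
    -- values at the q_j.
    refine ⟨∑ j, (k.1 (q j)).1 (p j),
      Subtype.ext (AddMonoidHom.ext fun t => Subtype.ext (AddMonoidHom.ext fun x => ?_))⟩
    rw [unitHom_apply, smul_sum']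
    have h1 : MulOpposite.op e • t = ∑ j, c.qp t (p j) • q j := by
      simp_rw [c.qp_smul]
      rw [← sum_smul', ← Finset.op_sum, hpq]
    rw [← he t, h1, map_sum, AddSubgroup.val_finsetSum, AddMonoidHom.finsetSum_apply]
    refine Finset.sum_congr rfl fun j _ => ?_
    rw [k.2.1, unitaryHom_smul_apply, ← c.pq_smul, (k.1 (q j)).2.1]

variable [SMulCommClass S Rᵐᵒᵖ Q]

theorem unitHom_smul (hM : IsUnitaryModule R M) (r : R) (m : M) :
    c.unitHom hR hS hQ hM (r • m) = r • c.unitHom hR hS hQ hM m :=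
  Subtype.ext (AddMonoidHom.ext fun q => Subtype.ext (AddMonoidHom.ext fun x => by
    change c.pq x q • r • m = c.pq x (MulOpposite.op r • q) • m
    rw [c.pq_smul_right, SemigroupAction.mul_smul]))

end Unit

variable [SMulCommClass R Sᵐᵒᵖ P] [SMulCommClass S Rᵐᵒᵖ Q]

/-- The unit isomorphism. -/
noncomputable def unitIso : 𝟭 (UMod R) ≅ homFunctor hS P ⋙ homFunctor (P := Q) hR :=
  NatIso.ofComponents (fun (M : UMod R) => UMod.isoOfBijective
    (UMod.ofHom (B := (homFunctor (P := Q) hR).obj ((homFunctor hS P).obj M))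
      (c.unitHom hR hS hQ M.unitary) (c.unitHom_smul hR hS hQ M.unitary))
    (c.unitHom_bijective hR hS hQ M.unitary)) fun f => UMod.hom_ext fun m =>
      Subtype.ext (AddMonoidHom.ext fun q => Subtype.ext (AddMonoidHom.ext fun x =>
        (UMod.hom_smul f (c.pq x q) m).symm))

include c hR hS hP hQ in
-- The context is symmetric in R and S, so the counit is the inverse of the unit of the swapped
-- context.
theorem areMoritaEquivalent : AreMoritaEquivalent R S :=
  ⟨CategoryTheory.Equivalence.mk (homFunctor hS P) (homFunctor hR Q) (c.unitIso hR hS hQ)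
    (c.swap.unitIso hS hR hP).symm⟩

end SurjectiveMoritaContext

open NonUnitalModule

namespace UMod

variable {R : Type u} [NonUnitalRing R]

/-- The trace ideal of a generator is the whole ring. -/
theorem exists_sum_of_isSeparator (hR : HasLocalUnits R) {M : UMod R} (hM : IsSeparator M)
    (r : R) : ∃ (ι : Type u) (_ : Fintype ι) (a : ι → (M ⟶ regular hR)) (x : ι → M.carrier),
      ∑ j, coeff (a j) (x j) = r := by
  -- Being a separator says that the maps M → R are jointly epimorphic, so their images add up to R.
  have h : ⨆ a : M ⟶ regular hR, range a = ⊤ :=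
    (jointlyEpi_iff _).1 fun _ f g => hM.def f g
  have hr : r ∈ ⨆ a : M ⟶ regular hR, range a := h ▸ trivial
  induction hr using AddSubgroup.iSup_induction' with
  | hp a r hr =>
    obtain ⟨x, rfl⟩ := hr
    exact ⟨PUnit, inferInstance, fun _ => a, fun _ => x, Fintype.sum_unique _⟩
  | h1 => exact ⟨PEmpty, inferInstance, PEmpty.elim, PEmpty.elim, Finset.sum_empty⟩
  | hadd r s _ _ ihr ihs =>
    obtain ⟨ι, _, a, x, rfl⟩ := ihr
    obtain ⟨κ, _, b, y, rfl⟩ := ihs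
    exact ⟨ι ⊕ κ, inferInstance, Sum.elim a b, Sum.elim x y, Fintype.sum_sum_type _⟩

end UMod

open UMod

/-- The right `R`-module structure `(a r)(x) = a(x) r` on the dual of `P`. -/
instance unitaryDualModule {R S P : Type u} [NonUnitalRing R] [NonUnitalRing S]
    (hS : HasLocalUnits S) [AddCommGroup P] [NonUnitalModule R P] [NonUnitalModule Sᵐᵒᵖ P] :
    NonUnitalModule Rᵐᵒᵖ (unitaryHom hS R P R) where
  smul r a := ⟨(AddMonoidHom.mulRight r.unop).comp a.1, fun t x => by
    change a.1 (t • x) * r.unop = t * (a.1 x * r.unop)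
    rw [a.2.1, regular_smul_def, mul_assoc], a.2.2.imp fun s hs x => congrArg (· * r.unop) (hs x)⟩
  smul_zero r := Subtype.ext (AddMonoidHom.ext fun x => zero_mul r.unop)
  smul_add r a b := Subtype.ext (AddMonoidHom.ext fun x => add_mul (a.1 x) (b.1 x) r.unop)
  mul_smul r t a := Subtype.ext (AddMonoidHom.ext fun x =>
    (mul_assoc (a.1 x) t.unop r.unop).symm)
  add_smul r t a := Subtype.ext (AddMonoidHom.ext fun x => mul_add (a.1 x) r.unop t.unop)

instance unitaryDual_smulCommClass {R S P : Type u} [NonUnitalRing R] [NonUnitalRing S]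
    (hS : HasLocalUnits S) [AddCommGroup P] [NonUnitalModule R P] [NonUnitalModule Sᵐᵒᵖ P]
    [SMulCommClass R Sᵐᵒᵖ P] : SMulCommClass S Rᵐᵒᵖ (unitaryHom hS R P R) :=
  ⟨fun _ _ _ => rfl⟩

/-! ### From the bimodule conditions to a Morita context -/

namespace UnitaryBimodule

variable {R S : Type u} [NonUnitalRing R] [NonUnitalRing S] {P : UnitaryBimodule R S}

theorem mu_injective_iff : Function.Injective P.mu ↔
    ∀ s t : S, (∀ x : P.carrier, MulOpposite.op s • x = MulOpposite.op t • x) → s = t := by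
  refine forall₂_congr fun s t => imp_congr_left ⟨fun h x => ?_, fun h => ?_⟩
  · exact DFunLike.congr_fun (congrArg (fun g : P.LeftEnd => g.unop.1) h) x
  · exact MulOpposite.unop_injective (Subtype.ext (AddMonoidHom.ext h))

theorem lam_injective_iff : Function.Injective P.lam ↔
    ∀ r : R, (∀ x : P.carrier, r • x = 0) → r = 0 := by
  rw [injective_iff_map_eq_zero]
  refine forall_congr' fun r => imp_congr_left ⟨fun h x => ?_, fun h => ?_⟩
  · exact DFunLike.congr_fun (congrArg (fun g : P.RightEnd => g.1) h) x
  · exact Subtype.ext (AddMonoidHom.ext h)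

/-- Im μ is an additive subgroup and μ_t = μ_t · 1, so only single products μ_s g have to be tested.
-/
theorem muIdeal_iff : P.MuIdeal ↔ ∀ (s : S) (g : P.left ⟶ P.left), ∃ t : S,
    ∀ x : P.carrier, g (MulOpposite.op s • x : P.carrier) = MulOpposite.op t • x := by
  constructor
  · intro h s g
    let g' : P.LeftEnd := MulOpposite.op ⟨toAddHom g, hom_smul g⟩
    have : P.mu s * g' ∈ Set.range P.mu := h ▸ AddSubgroup.subset_closure ⟨s, g', rfl⟩
    obtain ⟨t, ht⟩ := this
    exact ⟨t, fun x => (DFunLike.congr_fun (congrArg (fun g : P.LeftEnd => g.unop.1) ht) x).symm⟩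
  · intro h
    refine Set.Subset.antisymm ?_ ?_
    · refine (AddSubgroup.closure_le (K := (P.mu : S →+ P.LeftEnd).range)).2 ?_
      rintro _ ⟨s, g, rfl⟩
      obtain ⟨t, ht⟩ := h s (ofHom g.unop.1 g.unop.2)
      exact ⟨t, MulOpposite.unop_injective (Subtype.ext (AddMonoidHom.ext fun x => (ht x).symm))⟩
    · rintro _ ⟨t, rfl⟩
      exact AddSubgroup.subset_closure ⟨t, 1, (mul_one _).symm⟩

theorem lamIdeal_iff : P.LamIdeal ↔ ∀ (r : R) (g : P.right ⟶ P.right), ∃ t : R,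
    ∀ x : P.carrier, g (r • x : P.carrier) = t • x := by
  constructor
  · intro h r g
    let g' : P.RightEnd := ⟨toAddHom g, hom_smul g⟩
    have : g' * P.lam r ∈ Set.range P.lam := h ▸ AddSubgroup.subset_closure ⟨g', r, rfl⟩
    obtain ⟨t, ht⟩ := this
    exact ⟨t, fun x => (DFunLike.congr_fun (congrArg (fun g : P.RightEnd => g.1) ht) x).symm⟩
  · intro h
    refine Set.Subset.antisymm ?_ ?_
    · refine (AddSubgroup.closure_le (K := (P.lam : R →+ P.RightEnd).range)).2 ?_
      rintro _ ⟨g, r, rfl⟩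
      obtain ⟨t, ht⟩ := h r (ofHom g.1 g.2)
      exact ⟨t, Subtype.ext (AddMonoidHom.ext fun x => (ht x).symm)⟩
    · rintro _ ⟨t, rfl⟩
      exact AddSubgroup.subset_closure ⟨1, t, (one_mul _).symm⟩

theorem isRSubmodule_mulRight (f : S) : IsRSubmodule R (P.mulRight f) := by
  rintro r _ ⟨x, rfl⟩
  exact ⟨r • x, (smul_comm r (MulOpposite.op f) x).symm⟩

/-- The generators p_j f come from an expression f = ∑ b_j(p_j) and do not depend on the element yf
to be generated; only the coefficients t_j do. -/
theorem isFGSubmodule_mulRight (hR : HasLocalUnits R) (hS : HasLocalUnits S)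
    (hP : IsSeparator P.right) (hlam : P.LamIdeal) (f : S) (hf : f * f = f) :
    IsFGSubmodule R (P.mulRight f) := by
  classical
  rw [lamIdeal_iff] at hlam
  obtain ⟨ι, _, b, p, hbp⟩ : ∃ (ι : Type u) (_ : Fintype ι) (b : ι → (P.right ⟶ regular hS.op))
      (p : ι → P.carrier), ∑ j, coeff (b j) (p j) = MulOpposite.op f :=
    exists_sum_of_isSeparator hS.op hP (MulOpposite.op f)
  obtain ⟨e, -, he⟩ := P.left_unitary.exists_idempotent hR (Finset.univ.image p)
  refine ⟨isRSubmodule_mulRight f, Finset.univ.image fun j =>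
    MulOpposite.op f • p j, ?_, ?_⟩
  · intro x hx
    obtain ⟨j, -, rfl⟩ := Finset.mem_image.1 hx
    exact ⟨p j, rfl⟩
  · rintro K hK hXK _ ⟨y, rfl⟩
    -- x ↦ y b_j(x) is an endomorphism of P_S. Preceded by λ_e it is left multiplication by some
    -- t_j, and e fixes every p_j.
    choose t ht using fun j => hlam e (b j ≫ smulRight (A := P.right) hS.op y)
    have h1 : MulOpposite.op f • y = ∑ j, t j • p j := by
      rw [← hbp]
      refine (sum_smul' _ _ y).trans (Finset.sum_congr rfl fun j _ => ?_)
      rw [← ht j, he (p j) (by simp)]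
      rfl
    -- One more factor f moves the p_j into Pf.
    have h2 : MulOpposite.op f • y =
        ∑ j, t j • (MulOpposite.op f • p j) := by
      nth_rw 1 [← hf]
      rw [MulOpposite.op_mul, SemigroupAction.mul_smul, h1, smul_sum']
      exact Finset.sum_congr rfl fun j _ => (smul_comm _ _ _).symm
    change MulOpposite.op f • y ∈ K
    rw [h2]
    exact sum_mem fun j _ => hK _ _ (hXK (Finset.mem_coe.2
      (Finset.mem_image_of_mem (fun j => MulOpposite.op f • p j) (Finset.mem_univ j))))

/-- The element `x ↦ a(x s)` of the dual of `P`. -/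
def dualOf (hR : HasLocalUnits R) (hS : HasLocalUnits S) (s : S) (a : P.left ⟶ regular hR) :
    unitaryHom hS R P.carrier R :=
  ⟨(coeff a).comp (DistribSMul.toAddMonoidHom P.carrier (MulOpposite.op s)), fun r x => by
    change coeff a (MulOpposite.op s • r • x : P.carrier) = r * coeff a _
    rw [← smul_comm r (MulOpposite.op s) x]
    exact coeff_smul a r _, by
    obtain ⟨e, -, he⟩ := hS.exists_mul {s}
    refine ⟨e, fun x => ?_⟩
    change coeff a (MulOpposite.op s • MulOpposite.op e • x : P.carrier) =
      coeff a (MulOpposite.op s • x : P.carrier)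
    rw [← SemigroupAction.mul_smul, ← MulOpposite.op_mul, (he s (by simp)).1]⟩

theorem dualOf_apply (hR : HasLocalUnits R) (hS : HasLocalUnits S) (s : S)
    (a : P.left ⟶ regular hR) (x : P.carrier) :
    (dualOf hR hS s a).1 x = coeff a (MulOpposite.op s • x : P.carrier) := rfl

theorem nonempty_surjectiveMoritaContext (hR : HasLocalUnits R) (hS : HasLocalUnits S)
    (hP : P.left.IsLocallyProjectiveGenerator) (hmu : Function.Injective P.mu)
    (hmu' : P.MuIdeal) (hfg : ∀ f : S, f * f = f → IsFGSubmodule R (P.mulRight f)) :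
    Nonempty (SurjectiveMoritaContext R S P.carrier (unitaryHom hS R P.carrier R)) := by
  classical
  rw [mu_injective_iff] at hmu
  rw [muIdeal_iff] at hmu'
  -- If q(xs) = q(x), the endomorphism x ↦ q(x)p equals μ_s followed by itself, hence lies in (Im
  -- μ)End_R(P).
  have hex : ∀ (q : unitaryHom hS R P.carrier R) (p : P.carrier), ∃ s : S,
      ∀ x : P.carrier, MulOpposite.op s • x = q.1 x • p := by
    intro q p
    obtain ⟨s, hs⟩ := q.2.2
    obtain ⟨t, ht⟩ := hmu' s (ofHom (A := P.left) (B := P.left) ((smulHom R p).comp q.1)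
      fun r x => (congrArg (· • p) (q.2.1 r x)).trans (SemigroupAction.mul_smul r (q.1 x) p))
    exact ⟨t, fun x => (ht x).symm.trans (congrArg (· • p) (hs x))⟩
  choose σ hσ using hex
  let qp : unitaryHom hS R P.carrier R →+ P.carrier →+ S :=
    AddMonoidHom.mk' (fun q => AddMonoidHom.mk' (σ q) fun p p' => hmu _ _ fun x => by
      rw [MulOpposite.op_add, NonUnitalModule.add_smul, hσ, hσ, hσ, smul_add]) fun q q' =>
        AddMonoidHom.ext fun p => hmu _ _ fun x => by
          change _ = MulOpposite.op (σ q p + σ q' p) • x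
          rw [MulOpposite.op_add, NonUnitalModule.add_smul, hσ, hσ]
          exact (hσ _ _ _).trans (NonUnitalModule.add_smul _ _ _)
  have hqp : ∀ q p (x : P.carrier), MulOpposite.op (qp q p) • x = q.1 x • p := hσ
  refine ⟨{
    pq := AddMonoidHom.mk' (fun p => AddMonoidHom.mk' (fun q => q.1 p) fun _ _ => rfl)
      fun p p' => AddMonoidHom.ext fun q => map_add q.1 p p'
    qp := qp
    pq_smul_left := fun r p q => q.2.1 r p
    pq_smul_right := fun _ _ _ => rfl
    pq_balanced := fun _ _ _ => rfl
    qp_smul_left := fun s q p => hmu _ _ fun x => by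
      rw [MulOpposite.op_mul, SemigroupAction.mul_smul, hqp, hqp]; rfl
    qp_smul_right := fun s q p => hmu _ _ fun x => by
      rw [MulOpposite.op_mul, SemigroupAction.mul_smul, hqp, hqp]
      exact smul_comm _ _ _
    qp_balanced := fun r q p => hmu _ _ fun x => by
      rw [hqp, hqp]
      exact SemigroupAction.mul_smul (q.1 x) r p
    pq_smul := fun p q p' => (hqp q p' p).symm
    qp_smul := fun q p q' => Subtype.ext (AddMonoidHom.ext fun x => by
      rw [unitaryHom_smul_apply, hqp, q'.2.1]; rfl)
    exists_pq := fun r => ?_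
    exists_qp := fun s => ?_ }⟩
  · obtain ⟨ι, _, a, p, hap⟩ : ∃ (ι : Type u) (_ : Fintype ι) (a : ι → (P.left ⟶ regular hR))
        (p : ι → P.carrier), ∑ j, coeff (a j) (p j) = r := exists_sum_of_isSeparator hR hP.2 r
    -- An arbitrary functional need not lie in the unitary dual. Precomposing with an idempotent of
    -- S that fixes the p_j puts it there without changing its values at them.
    obtain ⟨s, -, hs⟩ := P.right_unitary.exists_idempotent hS.op (Finset.univ.image p)
    refine ⟨ι, inferInstance, p, fun j => dualOf hR hS s.unop (a j), ?_⟩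
    rw [← hap]
    refine Finset.sum_congr rfl fun j _ => ?_
    exact congrArg (coeff (a j)) (hs (p j) (by simp))
  · obtain ⟨f, hff, hf⟩ := hS.exists_mul {s}
    obtain ⟨-, X, -, hX⟩ := hfg f hff
    obtain ⟨ι, _, a, p, hap⟩ : ∃ (ι : Type u) (_ : Fintype ι) (a : ι → (P.left ⟶ regular hR))
        (p : ι → P.carrier), ∀ x ∈ X, ∑ j, coeff (a j) x • p j = x :=
      hP.1.exists_dualBasis hR X
    -- The submodule on which the dual basis reproduces vectors; it contains the generators of Pf,
    -- hence Pf.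
    let K : AddSubgroup P.carrier :=
      (∑ j, (smulHom R (p j)).comp (coeff (a j))).eqLocus (AddMonoidHom.id _)
    have hK : ∀ x : P.carrier, x ∈ K ↔ ∑ j, coeff (a j) x • p j = x := fun x =>
      Eq.congr_left (AddMonoidHom.finsetSum_apply _ _ _)
    have hlin : ∀ j (r : R) (x : P.carrier), coeff (a j) (r • x : P.carrier) = r * coeff (a j) x :=
      fun j => coeff_smul (a j)
    have hXK := hX K (fun r x hx => (hK _).2 (by
      simp_rw [hlin, SemigroupAction.mul_smul]
      rw [← smul_sum', (hK x).1 hx])) fun x hx => (hK x).2 (hap x hx)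
    -- Multiplying xf = ∑ a_j(xf)p_j by s and using fs = s gives s = ∑ [a_j(· f), p_j s].
    refine ⟨ι, inferInstance, fun j => dualOf hR hS f (a j),
      fun j => (MulOpposite.op s • p j : P.carrier), hmu _ _ fun x => ?_⟩
    have h1 : ∑ j, coeff (a j) (MulOpposite.op f • x : P.carrier) • p j =
      MulOpposite.op f • x := (hK _).1 (hXK ⟨x, rfl⟩)
    rw [Finset.op_sum, sum_smul']
    simp_rw [hqp, dualOf_apply, smul_comm _ (MulOpposite.op s)]
    rw [← smul_sum', h1, ← SemigroupAction.mul_smul, ← MulOpposite.op_mul, (hf s (by simp)).1]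

end UnitaryBimodule

/-! ### The right-hand properties of `P` from a context -/

namespace SurjectiveMoritaContext

variable {R S : Type u} [NonUnitalRing R] [NonUnitalRing S] {P : UnitaryBimodule R S} {Q : Type u}
    [AddCommGroup Q] [NonUnitalModule S Q] [NonUnitalModule Rᵐᵒᵖ Q]
    (c : SurjectiveMoritaContext R S P.carrier Q)

include c

/-- If r = ∑ (p_j, q_j), then rx = ∑ p_j[q_j, x], so g(rx) = ∑ g(p_j)[q_j, x] = ∑ (g(p_j), q_j)x. -/
theorem lamIdeal : P.LamIdeal := by
  refine UnitaryBimodule.lamIdeal_iff.2 fun r g => ?_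
  obtain ⟨ι, _, p, q, rfl⟩ := c.exists_pq r
  let g' : P.carrier →+ P.carrier := toAddHom g
  refine ⟨∑ j, c.pq (g' (p j)) (q j), fun x => ?_⟩
  rw [sum_smul', sum_smul']
  refine (map_sum g' _ _).trans (Finset.sum_congr rfl fun j _ => ?_)
  exact ((congrArg g' (c.pq_smul (p j) (q j) x)).trans (hom_smul g _ _)).trans
    (c.pq_smul (g' (p j)) (q j) x).symm

/-- Idempotents e of R act on P_S as a directed family of projections; e = ∑ (p_j, q_j) gives the
dual basis [q_j, ·], p_j. The maps x ↦ m[q_j, x] show that P_S is a generator. -/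
theorem isLocallyProjectiveGenerator_right (hR : HasLocalUnits R) (hS : HasLocalUnits S) :
    P.right.IsLocallyProjectiveGenerator := by
  constructor
  · have := IdempotentIndex.isDirectedOrder hR
    let π : R → (P.right ⟶ P.right) := fun r =>
      ofHom (A := P.right) (B := P.right) (P.lam r).1 (P.lam r).2
    have hπ : ∀ r t, π r ≫ π t = π (t * r) := fun r t =>
      hom_ext fun (x : P.carrier) => (SemigroupAction.mul_smul t r x).symm
    refine isLocallyProjective_of_idempotents (I := IdempotentIndex R) hS.op (fun e => π e.val)
      (fun e f h => ?_) (fun e f h => ?_) (fun (x : P.carrier) => ?_) fun e => ?_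
    · rw [hπ, h.2]
    · rw [hπ, h.1]
    · obtain ⟨e, he, h⟩ := P.left_unitary.exists_idempotent hR {x}
      exact ⟨⟨e, he⟩, h x (by simp)⟩
    · obtain ⟨ι, _, p, q, hpq⟩ := c.exists_pq e.val
      refine ⟨ι, inferInstance, fun j => ofHom (A := P.right) (B := regular hS.op)
        ((MulOpposite.opAddEquiv : S ≃+ Sᵐᵒᵖ).toAddMonoidHom.comp (c.qp (q j))) fun s x => ?_,
        p, fun (x : P.carrier) => ?_⟩
      · exact congrArg MulOpposite.op (c.qp_smul_right s.unop (q j) x)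
      · change _ = e.val • x
        rw [← hpq, sum_smul']
        exact Finset.sum_congr rfl fun j _ => (c.pq_smul _ _ _).symm
  · refine (isSeparator_def _).2 fun M B f g h => hom_ext fun m => ?_
    obtain ⟨s, hs⟩ := M.unitary.exists_smul_eq hS.op m
    obtain ⟨ι, _, q, p, hqp⟩ := c.exists_qp s.unop
    have hm : ∑ j, MulOpposite.op (c.qp (q j) (p j)) • m = m := by
      rw [← sum_smul', ← Finset.op_sum, hqp, MulOpposite.op_unop, hs]
    rw [← hm, map_sum, map_sum]
    refine Finset.sum_congr rfl fun j _ => ?_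
    exact congr_hom (h (ofHom (A := P.right) ((smulHom Sᵐᵒᵖ m).comp
      ((MulOpposite.opAddEquiv : S ≃+ Sᵐᵒᵖ).toAddMonoidHom.comp (c.qp (q j)))) fun s x =>
      (congrArg (fun t => MulOpposite.op t • m) (c.qp_smul_right s.unop (q j) x)).trans
        (SemigroupAction.mul_smul s (MulOpposite.op (c.qp (q j) x)) m))) (p j)

end SurjectiveMoritaContext

open NonUnitalModule

/-! ### Additivity of equivalences -/

namespace UMod

variable {R : Type u} [NonUnitalRing R]

variable {A B : UMod R}

instance : Add (A ⟶ B) where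
  add f g := ofHom (toAddHom f + toAddHom g) fun r x => by
    change f (r • x) + g (r • x) = r • (f x + g x)
    rw [hom_smul, hom_smul, smul_add]

instance : Zero (A ⟶ B) where
  zero := ofHom 0 fun r _ => (smul_zero r).symm

instance : Neg (A ⟶ B) where
  neg f := ofHom (-toAddHom f) fun r x => by
    change -f (r • x) = r • -f x
    rw [hom_smul, smul_neg']

instance homAddCommGroup : AddCommGroup (A ⟶ B) where
  add_assoc f g h := hom_ext fun x => add_assoc (f x) (g x) (h x)
  zero_add f := hom_ext fun x => zero_add (f x)
  add_zero f := hom_ext fun x => add_zero (f x)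
  add_comm f g := hom_ext fun x => add_comm (f x) (g x)
  neg_add_cancel f := hom_ext fun x => neg_add_cancel (f x)
  nsmul := nsmulRec
  zsmul := zsmulRec

instance : Preadditive (UMod R) where
  homGroup _ _ := homAddCommGroup
  add_comp _ _ _ f g h := hom_ext fun x => (toAddHom h).map_add (f x) (g x)
  comp_add _ _ _ _ _ _ := rfl

theorem hasBinaryProducts (hR : HasLocalUnits R) : HasBinaryProducts (UMod R) := by
  classical
  have : ∀ A B : UMod R, HasLimit (pair A B) := fun A B => by
    have hu : IsUnitaryModule R (A.carrier × B.carrier) := isUnitaryModule_of_forall fun x => by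
      obtain ⟨r, hr⟩ := A.unitary.exists_smul_eq hR x.1
      obtain ⟨s, hs⟩ := B.unitary.exists_smul_eq hR x.2
      obtain ⟨e, -, he⟩ := hR.exists_mul {r, s}
      refine ⟨e, Prod.ext ?_ ?_⟩
      · change e • x.1 = x.1
        rw [← hr, ← SemigroupAction.mul_smul, (he r (by simp)).1]
      · change e • x.2 = x.2
        rw [← hs, ← SemigroupAction.mul_smul, (he s (by simp)).1]
    let T : UMod R := ⟨A.carrier × B.carrier, hu⟩
    let p₁ : T ⟶ A := ofHom (AddMonoidHom.fst _ _) fun _ _ => rfl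
    let p₂ : T ⟶ B := ofHom (AddMonoidHom.snd _ _) fun _ _ => rfl
    exact ⟨⟨⟨BinaryFan.mk p₁ p₂, BinaryFan.isLimitMk
      (fun s => ofHom ((toAddHom s.fst).prod (toAddHom s.snd)) fun r x =>
        Prod.ext (hom_smul s.fst r x) (hom_smul s.snd r x))
      (fun s => rfl) (fun s => rfl)
      (fun s m h₁ h₂ => hom_ext fun x => Prod.ext (congr_hom h₁ x) (congr_hom h₂ x))⟩⟩⟩
  exact hasBinaryProducts_of_hasLimit_pair _

/-- Equivalences preserve binary products, which determine the addition of morphisms. The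
transported right action needs this to distribute over sums in S. -/
theorem additive_of_equivalence {S : Type u} [NonUnitalRing S] (hR : HasLocalUnits R)
    (e : UMod R ≌ UMod S) : e.functor.Additive := by
  have := hasBinaryProducts hR
  exact Functor.additive_of_preserves_binary_products _

theorem IsFG.range {M N : UMod R} (hM : M.IsFG) (f : M ⟶ N) : IsFGSubmodule R (range f) := by
  classical
  obtain ⟨-, X, -, hX⟩ := hM
  refine ⟨isRSubmodule_range f, X.image f, ?_, ?_⟩
  · intro y hy
    obtain ⟨x, -, rfl⟩ := Finset.mem_image.1 hy
    exact ⟨x, rfl⟩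
  · rintro K hK hXK _ ⟨x, rfl⟩
    exact hX (K.comap (toAddHom f)) (fun r x hx => by
        change f (r • x) ∈ K
        rw [hom_smul]
        exact hK r _ hx) (fun x hx => hXK (by
        simpa using ⟨x, hx, rfl⟩)) trivial

end UMod

open UMod

/-! ### The bimodule of an equivalence -/

section

variable {R S : Type u} [NonUnitalRing R] [NonUnitalRing S]

/-- Right multiplication `x ↦ x s` on the regular left module. -/
def mulRightHom (hS : HasLocalUnits S) (s : S) : regular hS ⟶ regular hS :=
  smulRight (A := regular hS) hS s

theorem mulRightHom_mul (hS : HasLocalUnits S) (s t : S) :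
    mulRightHom hS (s * t) = mulRightHom hS s ≫ mulRightHom hS t :=
  hom_ext fun (x : S) => (mul_assoc x s t).symm

theorem mulRightHom_add (hS : HasLocalUnits S) (s t : S) :
    mulRightHom hS (s + t) = mulRightHom hS s + mulRightHom hS t :=
  hom_ext fun (x : S) => mul_add x s t

theorem mulRightHom_injective (hS : HasLocalUnits S) : Function.Injective (mulRightHom hS) := by
  classical
  intro s t h
  obtain ⟨e, -, he⟩ := hS.exists_mul {s, t}
  have h1 : e * s = e * t := congr_hom h (e : S)
  rwa [(he s (by simp)).1, (he t (by simp)).1] at h1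

/-- A substitute for evaluation at 1: x = ex lies in the image of right multiplication by x. -/
theorem hom_ext_of_mulRightHom (hS : HasLocalUnits S) {M : UMod S} {f g : regular hS ⟶ M}
    (h : ∀ s, mulRightHom hS s ≫ f = mulRightHom hS s ≫ g) : f = g :=
  hom_ext fun (x : S) => by
    obtain ⟨e, -, he⟩ := hS.exists_mul {x}
    have h1 : f (e * x : S) = g (e * x : S) := congr_hom (h x) (e : S)
    rwa [(he x (by simp)).1] at h1

variable (hR : HasLocalUnits R) (hS : HasLocalUnits S) (e : UMod S ≌ UMod R)

/-- The right `S`-module structure on the image of the regular module under an equivalence. -/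
abbrev equivalenceRightModule : NonUnitalModule Sᵐᵒᵖ (e.functor.obj (regular hS)).carrier where
  smul s x := e.functor.map (mulRightHom hS s.unop) x
  smul_zero _ := map_zero _
  smul_add _ := map_add _
  mul_smul s t x := by
    change e.functor.map (mulRightHom hS (t.unop * s.unop)) x = _
    rw [mulRightHom_mul, Functor.map_comp]
    rfl
  add_smul s t x := by
    have := additive_of_equivalence hS e
    change e.functor.map (mulRightHom hS (s.unop + t.unop)) x = _
    rw [mulRightHom_add, Functor.map_add]
    rfl

/-- The bimodule attached to an equivalence of categories: the image of the regular module. -/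
def equivalenceBimodule : UnitaryBimodule R S :=
  letI := equivalenceRightModule hS e
  { carrier := (e.functor.obj (regular hS)).carrier
    smulComm := ⟨fun r s x => (hom_smul (e.functor.map (mulRightHom hS s.unop)) r x).symm⟩
    left_unitary := (e.functor.obj (regular hS)).unitary
    right_unitary := by
      refine eq_top_of_forall_hom (A := e.functor.obj (regular hS)) _ ?_ fun B f g h => ?_
      · intro r x hx
        induction hx using AddSubgroup.closure_induction with
        | mem x hx =>
          obtain ⟨s, m, rfl⟩ := hx
          exact AddSubgroup.subset_closure
            ⟨s, r • m, (hom_smul (e.functor.map (mulRightHom hS s.unop)) r m).symm⟩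
        | zero => rw [smul_zero]; exact zero_mem _
        | neg x _ ih => rw [smul_neg']; exact neg_mem ih
        | add x y _ _ ihx ihy => rw [smul_add]; exact add_mem ihx ihy
      -- Two maps agreeing on PS are transposed to maps out of S, where right multiplications are
      -- jointly epimorphic.
      · apply (e.toAdjunction.homEquiv _ _).injective
        refine hom_ext_of_mulRightHom hS fun s => ?_
        rw [← Adjunction.homEquiv_naturality_left, ← Adjunction.homEquiv_naturality_left]
        congr 1
        exact hom_ext fun x => h _ (AddSubgroup.subset_closure ⟨MulOpposite.op s, x, rfl⟩) }

theorem equivalenceBimodule_mu_injective :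
    Function.Injective (equivalenceBimodule hS e).mu :=
  UnitaryBimodule.mu_injective_iff.2 fun _ _ h =>
    mulRightHom_injective hS (e.functor.map_injective (hom_ext h))

/-- By fullness g comes from an endomorphism h of S, and right multiplication by s followed by h is
right multiplication by h(s). -/
theorem equivalenceBimodule_muIdeal : (equivalenceBimodule hS e).MuIdeal := by
  refine UnitaryBimodule.muIdeal_iff.2 fun s g => ?_
  obtain ⟨h, hh⟩ := e.functor.map_surjective
    (X := regular hS) (Y := regular hS) g
  refine ⟨h (s : S), fun x => ?_⟩
  have h1 : mulRightHom hS s ≫ h = mulRightHom hS (h (s : S)) :=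
    hom_ext fun (x : S) => hom_smul h x s
  have h2 := congrArg e.functor.map h1
  rw [Functor.map_comp, hh] at h2
  exact congr_hom h2 x

include hR in
-- Sf is generated by f = ff, so its image under the equivalence is finitely generated. Since S → Sf
-- stays epi, this image maps onto Pf.
theorem equivalenceBimodule_isFGSubmodule (f : S) (hf : f * f = f) :
    IsFGSubmodule R ((equivalenceBimodule hS e).mulRight f) := by
  have hfg : (image (mulRightHom hS f)).IsFG := by
    refine ⟨fun _ _ _ => trivial, {(toImage (mulRightHom hS f) f)}, fun _ _ => trivial,
      fun K hK hXK x _ => ?_⟩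
    obtain ⟨(y : S), rfl⟩ := toImage_surjective _ x
    have : toImage (mulRightHom hS f) y = y • toImage (mulRightHom hS f) f :=
      Subtype.ext (by
        change y * f = y * (f * f)
        rw [hf])
    rw [this]
    exact hK _ _ (hXK (by simp))
  have hepi : Epi (toImage (mulRightHom hS f)) :=
    epi_of_surjective _ (toImage_surjective _)
  have h1 := (hfg.map_equivalence hS hR e).range (e.functor.map (imageι (mulRightHom hS f)))
  have h2 : e.functor.map (mulRightHom hS f) = e.functor.map (toImage (mulRightHom hS f)) ≫
      e.functor.map (imageι (mulRightHom hS f)) := by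
    rw [← Functor.map_comp, toImage_ι]
  have h3 : Epi (e.functor.map (toImage (mulRightHom hS f))) := inferInstance
  have h4 : (equivalenceBimodule hS e).mulRight f =
      range (e.functor.map (imageι (mulRightHom hS f))) := by
    refine AddSubgroup.ext fun y => ⟨?_, ?_⟩
    · rintro ⟨x, rfl⟩
      exact ⟨_, (congr_hom h2 x).symm⟩
    · rintro ⟨x, rfl⟩
      obtain ⟨x, rfl⟩ := surjective_of_epi (e.functor.map (toImage (mulRightHom hS f))) x
      exact ⟨x, congr_hom h2 x⟩
  rw [h4]
  exact h1

end

theorem mainTheorem2 (R S : Type u) [NonUnitalRing R] [NonUnitalRing S]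
    (hR : HasLocalUnits R) (hS : HasLocalUnits S) :
    List.TFAE [
      AreMoritaEquivalent R S,
      ∃ P : UnitaryBimodule R S, P.IsBalanced ∧
        P.left.IsLocallyProjectiveGenerator ∧ P.right.IsLocallyProjectiveGenerator,
      ∃ P : UnitaryBimodule R S, P.left.IsLocallyProjectiveGenerator ∧
        (Function.Injective P.mu ∧ P.MuIdeal) ∧
        ∀ f : S, f * f = f → IsFGSubmodule R (P.mulRight f)] := by
  tfae_have 1 → 3 := by
    rintro ⟨e⟩
    exact ⟨equivalenceBimodule hS e.symm,
      (isLocallyProjectiveGenerator_regular hS).map_equivalence hS hR e.symm,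
      ⟨equivalenceBimodule_mu_injective hS e.symm, equivalenceBimodule_muIdeal hS e.symm⟩,
      equivalenceBimodule_isFGSubmodule hR hS e.symm⟩
  tfae_have 3 → 1 := by
    rintro ⟨P, hP, ⟨hmu, hmu'⟩, hfg⟩
    obtain ⟨c⟩ := P.nonempty_surjectiveMoritaContext hR hS hP hmu hmu' hfg
    exact c.areMoritaEquivalent hR hS P.left_unitary (unitaryHom_isUnitary hS)
  tfae_have 3 → 2 := by
    rintro ⟨P, hP, ⟨hmu, hmu'⟩, hfg⟩
    obtain ⟨c⟩ := P.nonempty_surjectiveMoritaContext hR hS hP hmu hmu' hfg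
    exact ⟨P, ⟨UnitaryBimodule.lam_injective_iff.2 (c.smul_injective hR), hmu, hmu', c.lamIdeal⟩,
      hP, c.isLocallyProjectiveGenerator_right hR hS⟩
  tfae_have 2 → 3 := by
    rintro ⟨P, ⟨-, hmu, hmu', hlam'⟩, hP, hP'⟩
    exact ⟨P, hP, ⟨hmu, hmu'⟩, UnitaryBimodule.isFGSubmodule_mulRight hR hS hP'.2 hlam'⟩
  tfae_finish
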